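/- Let $0<\beta\le 1$. There is a constant $C$, depending only on $\beta$, with the following property. Let $\Sigma_1,\Sigma_2,\Sigma_3\subset\mathbb{R}^3$ be nonempty sets with $\operatorname{diam}\Sigma_i\le 1$ such that for $i=1,2,3$ there are an open convex set $U_i\subset\mathbb{R}^3$ and a function $\Phi_i\in C^{1,\beta}(U_i)$ such that $\Sigma_i$ is a relatively open subset of the surface $$\Sigma_i^*=\{\sigma\in U_i \mid \Phi_i(\sigma)=0,\ \nabla\Phi_i(\sigma)\neq 0\},\qquad \operatorname{dist}(\Sigma_i,U_i^c)\ge \operatorname{diam}(\Sigma_i),$$ and such that, for suitable unit normal vector fields $\mathfrak n_i$ on $\Sigma_i^*$, $$\sup_{\sigma\ne\tilde\sigma\in\Sigma_i^*}\left(\frac{|\mathfrak n_i(\sigma)-\mathfrak n_i(\tilde\sigma)|}{|\sigma-\tilde\sigma|^{\beta}}+\frac{|\mathfrak n_i(\sigma)\cdot(\sigma-\tilde\sigma)|}{|\sigma-\tilde\sigma|^{1+\beta}}\right)\le 1\qquad(i=1,2,3)$$ and $$\tfrac12\le\det\big(\mathfrak n_1(\sigma_1),\mathfrak n_2(\sigma_2),\mathfrak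 n_3(\sigma_3)\big)\le 1\qquad\text{for all }(\sigma_1,\sigma_2,\sigma_3)\in\Sigma_1^*\times\Sigma_2^*\times\Sigma_3^*.$$ Let $\mu_i$ be the surface measure on $\Sigma_i$ and $L^2(\Sigma_i)=L^2(\Sigma_i,\mu_i)$ (complex-valued functions). For $f\in L^2(\Sigma_1)$, $g\in L^2(\Sigma_2)$ let $f\ast g$ be the distribution $$(f\ast g)(\psi)=\int_{\Sigma_1}\int_{\Sigma_2} f(x)\,g(y)\,\psi(x+y)\,d\mu_2(y)\,d\mu_1(x),\qquad \psi\in C_c^\infty(\mathbb{R}^3).$$ Then: (a) If $f\in C_c(\Sigma_1)$ and $g\in C_c(\Sigma_2)$, then $f\ast g$ is a continuous function of compact support on $\mathbb{R}^3$; in particular it can be restricted to $\Sigma_3$ pointwise. (b) For each $f\in L^2(\Sigma_1)$ and $g\in L^2(\Sigma_2)$ the restriction of $f\ast g$ to $\Sigma_3$ is a well-defined function in $L^2(\Sigma_3)$: there is a unique element of $L^2(\Sigma_3)$, denoted $(f\ast g)|_{\Sigma_3}$, such that $(f_k\ast g_k)|_{\Sigma_3}\to (f\ast g)|_{\Sigma_3}$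 in $L^2(\Sigma_3)$ for all sequences $f_k\in C_c(\Sigma_1)$, $g_k\in C_c(\Sigma_2)$ with $f_k\to f$ in $L^2(\Sigma_1)$ and $g_k\to g$ in $L^2(\Sigma_2)$. It satisfies $$\|f\ast g\|_{L^2(\Sigma_3)}\le C\,\|f\|_{L^2(\Sigma_1)}\|g\|_{L^2(\Sigma_2)}.$$ -/

import Mathlib

open MeasureTheory Filter Topology
open scoped NNReal ENNReal ContDiff

/-- Three-dimensional Euclidean space. -/
abbrev E3 : Type := EuclideanSpace ℝ (Fin 3)

/-- `Φ` is of class `C^{1,β}` on the open set `U`: it is continuously differentiable there and its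
gradient is locally Hölder continuous of exponent `β`. (A global Hölder bound for the gradient
implies this.) -/
def IsC1Holder (β : ℝ≥0) (U : Set E3) (Φ : E3 → ℝ) : Prop :=
  ContDiffOn ℝ 1 Φ U ∧
    ∀ x ∈ U, ∃ C : ℝ≥0, ∃ V ∈ 𝓝 x, HolderOnWith C β (gradient Φ) V

/-- The surface `{σ ∈ U | Φ σ = 0, ∇Φ σ ≠ 0}`. -/
def levelSurface (U : Set E3) (Φ : E3 → ℝ) : Set E3 :=
  {σ | σ ∈ U ∧ Φ σ = 0 ∧ gradient Φ σ ≠ 0}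

/-- `S` is a nonempty bounded relatively open piece of the larger surface
`S* = levelSurface U Φ`, oriented by the unit normal field `n`. -/
structure IsSurfacePiece (β : ℝ≥0) (b : ℝ) (S U : Set E3) (Φ : E3 → ℝ) (n : E3 → E3) :
    Prop where
  nonempty : S.Nonempty
  bounded : Bornology.IsBounded S
  relOpen : ∃ V : Set E3, IsOpen V ∧ S = levelSurface U Φ ∩ V
  isOpen_U : IsOpen U
  convex_U : Convex ℝ U
  regular : IsC1Holder β U Φ
  /-- `dist (S, Uᶜ) ≥ diam S` (void if `U` is the whole space) -/
  dist_compl : ∀ x ∈ S, ∀ y ∈ Uᶜ, Metric.diam S ≤ dist x y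
  norm_normal : ∀ σ ∈ levelSurface U Φ, ‖n σ‖ = 1
  normal_dir : ∀ σ ∈ levelSurface U Φ, ∃ c : ℝ, n σ = c • gradient Φ σ
  holder : ∀ σ ∈ levelSurface U Φ, ∀ τ ∈ levelSurface U Φ, σ ≠ τ →
    ‖n σ - n τ‖ / ‖σ - τ‖ ^ (β : ℝ) + |inner ℝ (n σ) (σ - τ)| / ‖σ - τ‖ ^ (1 + (β : ℝ)) ≤ b

/-- The standing assumption on a triple of surfaces, with Hölder exponent `β`, Hölder constant `b`
and transversality constant `θ`. The matrix in the last clause has the columns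
`n 0 (σ 0)`, `n 1 (σ 1)`, `n 2 (σ 2)`. -/
def TransversalTriple (β : ℝ≥0) (b θ : ℝ) (S : Fin 3 → Set E3) : Prop :=
  ∃ (U : Fin 3 → Set E3) (Φ : Fin 3 → E3 → ℝ) (n : Fin 3 → E3 → E3),
    (∀ i, IsSurfacePiece β b (S i) (U i) (Φ i) (n i)) ∧
    ∀ σ : Fin 3 → E3, (∀ i, σ i ∈ levelSurface (U i) (Φ i)) →
      θ ≤ (Matrix.of fun k i => n i (σ i) k).det ∧
        (Matrix.of fun k i => n i (σ i) k).det ≤ 1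

/-- Surface measure on `S`: the two-dimensional Hausdorff measure, normalized to agree with area on
planes, restricted to `S`. -/
noncomputable def surfaceMeasure (S : Set E3) : Measure E3 :=
  (Measure.euclideanHausdorffMeasure 2 : Measure E3).restrict S

/-- `f` is (the extension by zero of) a continuous function on `S` whose support is a compact
subset of `S`. -/
def IsCcOn (S : Set E3) (f : E3 → ℂ) : Prop :=
  ContinuousOn f S ∧ ∃ K : Set E3, IsCompact K ∧ K ⊆ S ∧ ∀ x, x ∉ K → f x = 0

/-- The convolution of `f dμ₁` and `g dμ₂`, with `μᵢ` the surface measure of `Sᵢ`, as a functional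
on test functions. -/
noncomputable def surfaceConv (S₁ S₂ : Set E3) (f g ψ : E3 → ℂ) : ℂ :=
  ∫ x, ∫ y, f x * g y * ψ (x + y) ∂(surfaceMeasure S₂) ∂(surfaceMeasure S₁)

/-- The distribution `f ∗ g` is the continuous function `h` of compact support. (Such an `h` is
unique.) -/
def IsContinuousConv (S₁ S₂ : Set E3) (f g h : E3 → ℂ) : Prop :=
  Continuous h ∧ HasCompactSupport h ∧
    ∀ ψ : E3 → ℂ, ContDiff ℝ ∞ ψ → HasCompactSupport ψ →
      ∫ v, h v * ψ v = surfaceConv S₁ S₂ f g ψ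

/-- `F` is the restriction of `f ∗ g` to `S₃`, defined by density: for any approximation of `f` and
`g` in `L²` by continuous functions of compact support in the surfaces, the pointwise restrictions
to `S₃` of the (continuous) convolutions converge to `F` in `L²(S₃)`. -/
def IsConvRestriction (S₁ S₂ S₃ : Set E3) (f : Lp ℂ 2 (surfaceMeasure S₁))
    (g : Lp ℂ 2 (surfaceMeasure S₂)) (F : Lp ℂ 2 (surfaceMeasure S₃)) : Prop :=
  ∀ φ γ h : ℕ → E3 → ℂ,
    (∀ k, IsCcOn S₁ (φ k)) → (∀ k, IsCcOn S₂ (γ k)) →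
    (∀ k, IsContinuousConv S₁ S₂ (φ k) (γ k) (h k)) →
    Tendsto (fun k => eLpNorm (fun x => φ k x - f x) 2 (surfaceMeasure S₁)) atTop (𝓝 0) →
    Tendsto (fun k => eLpNorm (fun x => γ k x - g x) 2 (surfaceMeasure S₂)) atTop (𝓝 0) →
    Tendsto (fun k => eLpNorm (fun x => h k x - F x) 2 (surfaceMeasure S₃)) atTop (𝓝 0)

/-! ### The area formula for injective immersions -/

section AreaFormula

/-! Continuity of `f ∗ g`. In local charts `G₁`, `G₂` the area formula turns the two surface
measures into continuous densities on plane domains, so `f ∗ g` is the push-forward of a continuous,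
compactly supported density on an open subset of ℝ⁴ under `(u, v) ↦ G₁ u + G₂ v`. The determinant
condition makes the normals of the first two surfaces independent, hence this map is a C¹
submersion. A submersion is locally a linear surjection after a C¹ change of variables, and for a
linear surjection the push-forward density is an integral over the fibres, which is continuous
(`exists_density_of_submersion`).

The L² bound. Mollify `f ∗ g` by a bump `k` of width `ε` and height of order `ε⁻³`. Cauchy–Schwarz
with weight `k` pairs `|f|²` with `k` integrated over the second surface and `|g|²` with `k`
integrated over the first (`lintegral_conv_sq_le`). It then suffices to bound, uniformly in `p` and
`q`, the integral over the third surface of the product of these two averages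
(`exists_lintegral_kernel_le`). Each average is at most of order `ε⁻³ · ε²`, because surface measure
grows quadratically. The product lives on points of the third surface that are `ε`-close to a
translate of the first and to a translate of the second. By transversality
(`exists_norm_sub_le_of_transversal`) these points lie in boundedly many balls of radius `146 ε`, a
set of measure of order `ε²`. All powers of `ε` cancel, and Fatou's lemma removes the mollification.

Every radius and constant comes from `β` alone, so the bound is uniform over all triples. Density of
`C_c` in L² and bilinearity give the extension to L². -/

theorem measure_le_of_locally_le {X : Type*} [TopologicalSpace X] [SecondCountableTopology X]
    [MeasurableSpace X] [OpensMeasurableSpace X] {ν ν' : Measure X} {Ω : Set X}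
    (h : ∀ x ∈ Ω, ∃ V ∈ 𝓝 x, ∀ B ⊆ V, MeasurableSet B → ν B ≤ ν' B) {B : Set X}
    (hB : MeasurableSet B) (hBΩ : B ⊆ Ω) : ν B ≤ ν' B := by
  choose! V hV hle using h
  obtain ⟨t, htΩ, htc, ht⟩ := TopologicalSpace.countable_cover_nhdsWithin
    (f := fun x => interior (V x)) (s := Ω)
    fun x hx => mem_nhdsWithin_of_mem_nhds (interior_mem_nhds.2 (hV x hx))
  rcases t.eq_empty_or_nonempty with he | hne
  · have hBe : B = ∅ := by
      rcases B.eq_empty_or_nonempty with h0 | ⟨b, hb⟩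
      · exact h0
      · have := ht (hBΩ hb)
        simp only [Set.mem_iUnion] at this
        obtain ⟨x, hx, -⟩ := this
        simp [he] at hx
    simp [hBe]
  obtain ⟨s, hs⟩ := htc.exists_eq_range hne
  have hsΩ : ∀ n, s n ∈ Ω := fun n => htΩ (hs.symm.subset ⟨n, rfl⟩)
  -- Making the countable cover disjoint lets the local inequalities add up exactly.
  set W : ℕ → Set X := disjointed fun n => interior (V (s n))
  have hWm : ∀ n, MeasurableSet (W n) :=
    fun n => MeasurableSet.disjointed (fun n => isOpen_interior.measurableSet) n
  have hBW : B = ⋃ n, B ∩ W n := by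
    rw [← Set.inter_iUnion, iUnion_disjointed]
    refine (Set.inter_eq_left.2 fun b hb => ?_).symm
    have := ht (hBΩ hb)
    simp only [Set.mem_iUnion] at this ⊢
    obtain ⟨x, hx, hbx⟩ := this
    rw [hs] at hx
    obtain ⟨n, rfl⟩ := hx
    exact ⟨n, hbx⟩
  have hdis : Pairwise (Function.onFun Disjoint fun n => B ∩ W n) := fun i j hij =>
    (disjoint_disjointed _ hij).mono Set.inter_subset_right Set.inter_subset_right
  rw [hBW, measure_iUnion hdis fun n => hB.inter (hWm n),
    measure_iUnion hdis fun n => hB.inter (hWm n)]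
  refine ENNReal.tsum_le_tsum fun n => hle (s n) (hsΩ n) _ ?_ (hB.inter (hWm n))
  exact Set.inter_subset_right.trans ((disjointed_subset _ n).trans interior_subset)

/-- The hypothesis makes `f` factor through `g` on `B`: points with equal `g`-values have equal
`f`-values, and the induced map on `g '' B` is `K`-Lipschitz. It serves to compare a surface with
its tangent plane. -/
theorem euclideanHausdorffMeasure_image_le_of_edist_le {X Y Z : Type*} [EMetricSpace Y]
    [MeasurableSpace Y] [BorelSpace Y] [EMetricSpace Z] [MeasurableSpace Z] [BorelSpace Z]
    (d : ℕ) {f : X → Y} {g : X → Z} {K : ℝ≥0} {B : Set X}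
    (h : ∀ x ∈ B, ∀ y ∈ B, edist (f x) (f y) ≤ K * edist (g x) (g y)) :
    (Measure.euclideanHausdorffMeasure d : Measure Y) (f '' B) ≤
      (K : ℝ≥0∞) ^ d * (Measure.euclideanHausdorffMeasure d : Measure Z) (g '' B) := by
  rcases B.eq_empty_or_nonempty with rfl | ⟨b, hb⟩
  · simp
  have : Nonempty X := ⟨b⟩
  set F : Z → Y := f ∘ Function.invFunOn g B
  have hF : ∀ x ∈ B, F (g x) = f x := by
    intro x hx
    have h1 : Function.invFunOn g B (g x) ∈ B := Function.invFunOn_mem ⟨x, hx, rfl⟩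
    have h2 : g (Function.invFunOn g B (g x)) = g x := Function.invFunOn_eq ⟨x, hx, rfl⟩
    have := h _ h1 x hx
    rw [h2, edist_self, mul_zero, nonpos_iff_eq_zero, edist_eq_zero] at this
    exact this
  have hlip : LipschitzOnWith K F (g '' B) := by
    rintro _ ⟨x, hx, rfl⟩ _ ⟨y, hy, rfl⟩
    rw [hF x hx, hF y hy]
    exact h x hx y hy
  have himg : f '' B = F '' (g '' B) := by
    rw [Set.image_image]
    exact Set.image_congr fun x hx => (hF x hx).symm
  have := hlip.hausdorffMeasure_image_le (d := d) (by positivity)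
  simp only [Measure.euclideanHausdorffMeasure_def, Measure.smul_apply, himg]
  rw [ENNReal.rpow_natCast] at this
  rw [ENNReal.smul_def, ENNReal.smul_def, smul_eq_mul, smul_eq_mul, mul_left_comm]
  gcongr

variable {U V : Type*} [NormedAddCommGroup U] [InnerProductSpace ℝ U] [FiniteDimensional ℝ U]
  [NormedAddCommGroup V] [InnerProductSpace ℝ V]

theorem continuous_normDet [CompleteSpace V] : Continuous fun f : U →L[ℝ] V => (f : U →ₗ[ℝ] V).normDet := by
  have : CompleteSpace U := FiniteDimensional.complete ℝ U
  have h : (fun f : U →L[ℝ] V => (f : U →ₗ[ℝ] V).normDet) =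
      fun f => √((ContinuousLinearMap.adjoint f ∘L f).det) := by
    ext f
    rw [← ContinuousLinearMap.normDet_sq]
    exact (Real.sqrt_sq (LinearMap.normDet_nonneg _)).symm
  rw [h]
  refine Real.continuous_sqrt.comp (ContinuousLinearMap.continuous_det.comp ?_)
  exact (ContinuousLinearMap.adjoint (𝕜 := ℝ) (E := U) (F := V)).continuous.clm_comp continuous_id

theorem HasStrictFDerivAt.exists_nhds_norm_sub_comparable {G : U → V} {A : U →L[ℝ] V} {u : U}
    (hG : HasStrictFDerivAt G A u) (hA : Function.Injective A) {K : ℝ} (hK : 1 < K) :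
    ∃ W ∈ 𝓝 u, ∀ x ∈ W, ∀ y ∈ W, ‖G x - G y‖ ≤ K * ‖A x - A y‖ ∧
      ‖A x - A y‖ ≤ K * ‖G x - G y‖ := by
  obtain ⟨k, hk, hkA⟩ := LinearMap.exists_antilipschitzWith (A : U →ₗ[ℝ] V)
    (LinearMap.ker_eq_bot.2 hA)
  have hk' : (0 : ℝ) < k := hk
  -- With this choice `1 - η = 1 / K` exactly, while `1 + η ≤ K`; these are the two sides of the
  -- comparison.
  set η : ℝ := (K - 1) / K with hη
  have hη0 : 0 < η := div_pos (by linarith) (by linarith)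
  have hc : 0 < (η / k).toNNReal := Real.toNNReal_pos.2 (div_pos hη0 hk')
  obtain ⟨W, hW, happ⟩ := hG.approximates_deriv_on_nhds (c := (η / k).toNNReal) (Or.inr hc)
  refine ⟨W, hW, fun x hx y hy => ?_⟩
  have h1 := happ x hx y hy
  rw [Real.coe_toNNReal _ (div_pos hη0 hk').le, map_sub] at h1
  have h2 : ‖x - y‖ ≤ k * ‖A x - A y‖ := by
    simpa [dist_eq_norm] using hkA.le_mul_dist x y
  have h3 : ‖G x - G y - (A x - A y)‖ ≤ η * ‖A x - A y‖ := by
    refine h1.trans ?_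
    calc η / k * ‖x - y‖ ≤ η / k * (k * ‖A x - A y‖) := by gcongr
      _ = _ := by field_simp
  have hKη : K * η = K - 1 := by rw [hη]; field_simp
  have h4 : ‖G x - G y‖ ≤ (1 + η) * ‖A x - A y‖ := by
    have := norm_add_le (G x - G y - (A x - A y)) (A x - A y)
    rw [sub_add_cancel] at this
    linarith
  have h5 : (1 - η) * ‖A x - A y‖ ≤ ‖G x - G y‖ := by
    have := norm_sub_le (G x - G y) (G x - G y - (A x - A y))
    rw [sub_sub_cancel] at this
    linarith
  have hηK : η ≤ K - 1 := by rw [← hKη]; nlinarith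
  refine ⟨h4.trans (by gcongr; linarith), ?_⟩
  calc ‖A x - A y‖ = K * ((1 - η) * ‖A x - A y‖) := by
        have : K * (1 - η) = 1 := by linarith
        rw [← mul_assoc, this, one_mul]
    _ ≤ _ := by gcongr

theorem ENNReal.le_of_forall_one_lt_pow_mul {x y : ℝ≥0∞} (n : ℕ)
    (h : ∀ K : ℝ≥0, 1 < K → x ≤ (K : ℝ≥0∞) ^ n * y) : x ≤ y := by
  have ht : Tendsto (fun K : ℝ≥0 => (K : ℝ≥0∞) ^ n * y) (𝓝[>] 1) (𝓝 (1 * y)) := by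
    refine ENNReal.Tendsto.mul_const ?_ (Or.inl one_ne_zero)
    have : Tendsto (fun K : ℝ≥0 => (K : ℝ≥0∞) ^ n) (𝓝 1) (𝓝 (((1 : ℝ≥0) : ℝ≥0∞) ^ n)) :=
      ((ENNReal.continuous_pow n).comp ENNReal.continuous_coe).tendsto 1
    simpa using this.mono_left nhdsWithin_le_nhds
  rw [one_mul] at ht
  refine ge_of_tendsto ht ?_
  filter_upwards [self_mem_nhdsWithin] with K hK using h K hK

variable [MeasurableSpace U] [BorelSpace U] [MeasurableSpace V] [BorelSpace V]
  [CompleteSpace V]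

/-- Replacing `G` by its linearization at `u` costs `K ^ finrank` in Hausdorff measure, and freezing
the Jacobian at `u` costs one more factor `K`; for the linear map the formula is exact. -/
theorem exists_nhds_euclideanHausdorffMeasure_image_comparable {G : U → V} {Ω : Set U}
    (hΩ : IsOpen Ω) (hG : ContDiffOn ℝ 1 G Ω)
    (hder : ∀ u ∈ Ω, Function.Injective (fderiv ℝ G u)) {u : U} (hu : u ∈ Ω)
    {K : ℝ≥0} (hK : 1 < K) :
    ∃ W ∈ 𝓝 u, ∀ B ⊆ W, MeasurableSet B →
      (Measure.euclideanHausdorffMeasure (Module.finrank ℝ U) : Measure V) (G '' B) ≤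
        (K : ℝ≥0∞) ^ (Module.finrank ℝ U + 1) *
          ∫⁻ x in B, ENNReal.ofReal (fderiv ℝ G x : U →ₗ[ℝ] V).normDet ∧
      ∫⁻ x in B, ENNReal.ofReal (fderiv ℝ G x : U →ₗ[ℝ] V).normDet ≤
        (K : ℝ≥0∞) ^ (Module.finrank ℝ U + 1) *
          (Measure.euclideanHausdorffMeasure (Module.finrank ℝ U) : Measure V) (G '' B) := by
  have hGu : ContDiffAt ℝ 1 G u := hG.contDiffAt (hΩ.mem_nhds hu)
  obtain ⟨W, hW, hWG⟩ := (hGu.hasStrictFDerivAt (by simp)).exists_nhds_norm_sub_comparable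
    (hder u hu) (K := K) (by exact_mod_cast hK)
  set A := fderiv ℝ G u
  set c : U → ℝ := fun x => (fderiv ℝ G x : U →ₗ[ℝ] V).normDet
  have hc : ContinuousAt c u := by
    have : ContinuousOn (fderiv ℝ G) Ω := hG.continuousOn_fderiv_of_isOpen hΩ le_rfl
    exact ContinuousAt.comp (f := fderiv ℝ G) continuous_normDet.continuousAt
      (this.continuousAt (hΩ.mem_nhds hu))
  have hcpos : 0 < c u := by
    refine lt_of_le_of_ne (LinearMap.normDet_nonneg _) (Ne.symm ?_)
    rw [Ne, LinearMap.normDet_eq_zero_iff_ker_ne_bot, not_not, LinearMap.ker_eq_bot]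
    exact hder u hu
  have hK' : (1 : ℝ) < K := by exact_mod_cast hK
  have h1 : ∀ᶠ x in 𝓝 u, c x < K * c u := hc.eventually_lt_const (by nlinarith)
  have h2 : ∀ᶠ x in 𝓝 u, c u / K < c x :=
    hc.eventually_const_lt (by rw [div_lt_iff₀ (by linarith)]; nlinarith)
  refine ⟨_, inter_mem hW (h1.and h2), fun B hB hBm => ?_⟩
  have hAB : (Measure.euclideanHausdorffMeasure (Module.finrank ℝ U) : Measure V) (A '' B) =
      ENNReal.ofReal (c u) * volume B :=
    LinearMap.euclideanHausdorffMeasure_image_eq_normDet_mul_volume (A : U →ₗ[ℝ] V) B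
  have hGA := euclideanHausdorffMeasure_image_le_of_edist_le (Module.finrank ℝ U)
    (f := G) (g := A) (K := K) (B := B) fun x hx y hy => by
      have := (hWG x (hB hx).1 y (hB hy).1).1
      rw [edist_dist, edist_dist, ← ENNReal.ofReal_coe_nnreal, ← ENNReal.ofReal_mul K.coe_nonneg,
        dist_eq_norm, dist_eq_norm]
      exact ENNReal.ofReal_le_ofReal this
  have hAG := euclideanHausdorffMeasure_image_le_of_edist_le (Module.finrank ℝ U)
    (f := A) (g := G) (K := K) (B := B) fun x hx y hy => by
      have := (hWG x (hB hx).1 y (hB hy).1).2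
      rw [edist_dist, edist_dist, ← ENNReal.ofReal_coe_nnreal, ← ENNReal.ofReal_mul K.coe_nonneg,
        dist_eq_norm, dist_eq_norm]
      exact ENNReal.ofReal_le_ofReal this
  have hlow : ENNReal.ofReal (c u) * volume B ≤ K * ∫⁻ x in B, ENNReal.ofReal (c x) := by
    rw [← setLIntegral_const, ← lintegral_const_mul' _ _ ENNReal.coe_ne_top]
    refine setLIntegral_mono' hBm fun x hx => ?_
    have : c u / K < c x := (hB hx).2.2
    rw [div_lt_iff₀ (by linarith)] at this
    rw [← ENNReal.ofReal_coe_nnreal, ← ENNReal.ofReal_mul (by positivity)]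
    exact ENNReal.ofReal_le_ofReal (by linarith)
  have hup : ∫⁻ x in B, ENNReal.ofReal (c x) ≤ K * (ENNReal.ofReal (c u) * volume B) := by
    rw [← setLIntegral_const, ← lintegral_const_mul' _ _ ENNReal.coe_ne_top]
    refine setLIntegral_mono' hBm fun x hx => ?_
    have : c x < K * c u := (hB hx).2.1
    rw [← ENNReal.ofReal_coe_nnreal, ← ENNReal.ofReal_mul (by positivity)]
    exact ENNReal.ofReal_le_ofReal this.le
  constructor
  · calc _ ≤ _ := hGA
      _ ≤ (K : ℝ≥0∞) ^ Module.finrank ℝ U * (K * ∫⁻ x in B, ENNReal.ofReal (c x)) := by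
        rw [hAB]; gcongr
      _ = _ := by rw [pow_succ, mul_assoc]
  · calc _ ≤ _ := hup
      _ ≤ K * ((K : ℝ≥0∞) ^ Module.finrank ℝ U *
          (Measure.euclideanHausdorffMeasure (Module.finrank ℝ U) : Measure V) (G '' B)) := by
        rw [← hAB]; gcongr
      _ = _ := by rw [pow_succ', mul_assoc]

/-- The **area formula** for an injective immersion of class `C¹`. -/
theorem euclideanHausdorffMeasure_image_eq_lintegral_normDet {G : U → V} {Ω : Set U}
    (hΩ : IsOpen Ω) (hG : ContDiffOn ℝ 1 G Ω) (hinj : Set.InjOn G Ω)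
    (hder : ∀ u ∈ Ω, Function.Injective (fderiv ℝ G u)) {B : Set U} (hB : MeasurableSet B)
    (hBΩ : B ⊆ Ω) :
    (Measure.euclideanHausdorffMeasure (Module.finrank ℝ U) : Measure V) (G '' B) =
      ∫⁻ x in B, ENNReal.ofReal (fderiv ℝ G x : U →ₗ[ℝ] V).normDet := by
  have hemb : MeasurableEmbedding (Ω.domRestrict G) :=
    hG.continuousOn.measurableEmbedding hΩ.measurableSet hinj
  set H : Measure V := Measure.euclideanHausdorffMeasure (Module.finrank ℝ U)
  -- Injectivity makes `B ↦ H (G '' B)` a measure, so the local two-sided comparison with `m`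
  -- globalizes, after which `K` tends to `1`.
  set ν : Measure U := (H.comap (Ω.domRestrict G)).map Subtype.val
  have hν : ∀ B ⊆ Ω, MeasurableSet B → ν B = H (G '' B) := by
    intro B hB hBm
    rw [Measure.map_apply measurable_subtype_coe hBm, hemb.comap_apply]
    congr 1
    ext y
    constructor
    · rintro ⟨x, hx, rfl⟩
      exact ⟨x, hx, rfl⟩
    · rintro ⟨x, hx, rfl⟩
      exact ⟨⟨x, hB hx⟩, hx, rfl⟩
  set m : Measure U :=
    volume.withDensity fun x => ENNReal.ofReal (fderiv ℝ G x : U →ₗ[ℝ] V).normDet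
  rw [← hν B hBΩ hB, ← withDensity_apply _ hB]
  apply le_antisymm
  · refine ENNReal.le_of_forall_one_lt_pow_mul (Module.finrank ℝ U + 1) fun K hK => ?_
    rw [← smul_eq_mul, ← Measure.smul_apply]
    refine measure_le_of_locally_le (Ω := Ω) (fun u hu => ?_) hB hBΩ
    obtain ⟨W, hW, h⟩ :=
      exists_nhds_euclideanHausdorffMeasure_image_comparable hΩ hG hder hu hK
    refine ⟨W ∩ Ω, inter_mem hW (hΩ.mem_nhds hu), fun B hB hBm => ?_⟩
    rw [hν B (hB.trans Set.inter_subset_right) hBm, Measure.smul_apply, withDensity_apply _ hBm]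
    exact (h B (hB.trans Set.inter_subset_left) hBm).1
  · refine ENNReal.le_of_forall_one_lt_pow_mul (Module.finrank ℝ U + 1) fun K hK => ?_
    rw [← smul_eq_mul, ← Measure.smul_apply]
    refine measure_le_of_locally_le (Ω := Ω) (fun u hu => ?_) hB hBΩ
    obtain ⟨W, hW, h⟩ :=
      exists_nhds_euclideanHausdorffMeasure_image_comparable hΩ hG hder hu hK
    refine ⟨W ∩ Ω, inter_mem hW (hΩ.mem_nhds hu), fun B hB hBm => ?_⟩
    rw [Measure.smul_apply, hν B (hB.trans Set.inter_subset_right) hBm, withDensity_apply _ hBm]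
    exact (h B (hB.trans Set.inter_subset_left) hBm).2

theorem map_domRestrict_withDensity_normDet {G : U → V} {Ω : Set U}
    (hΩ : IsOpen Ω) (hG : ContDiffOn ℝ 1 G Ω) (hinj : Set.InjOn G Ω)
    (hder : ∀ u ∈ Ω, Function.Injective (fderiv ℝ G u)) :
    Measure.map (Ω.domRestrict G) (Measure.comap Subtype.val (volume.withDensity fun x =>
      ENNReal.ofReal (fderiv ℝ G x : U →ₗ[ℝ] V).normDet)) =
    (Measure.euclideanHausdorffMeasure (Module.finrank ℝ U) : Measure V).restrict (G '' Ω) := by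
  have hemb : MeasurableEmbedding (Ω.domRestrict G) :=
    hG.continuousOn.measurableEmbedding hΩ.measurableSet hinj
  have hsub := MeasurableEmbedding.subtype_coe hΩ.measurableSet
  ext s hs
  have hm : MeasurableSet (Subtype.val '' (Ω.domRestrict G ⁻¹' s)) :=
    hsub.measurableSet_image.2 (hemb.measurable hs)
  rw [Measure.map_apply hemb.measurable hs, hsub.comap_apply, withDensity_apply _ hm,
    Measure.restrict_apply hs, ← euclideanHausdorffMeasure_image_eq_lintegral_normDet hΩ hG hinj
      hder hm (by simp)]
  congr 1
  ext y
  constructor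
  · rintro ⟨_, ⟨x, hx, rfl⟩, rfl⟩
    exact ⟨hx, x, x.2, rfl⟩
  · rintro ⟨hy, x, hx, rfl⟩
    exact ⟨x, ⟨⟨x, hx⟩, hy, rfl⟩, rfl⟩

theorem setIntegral_image_eq_setIntegral_normDet_smul {G : U → V} {Ω : Set U}
    (hΩ : IsOpen Ω) (hG : ContDiffOn ℝ 1 G Ω) (hinj : Set.InjOn G Ω)
    (hder : ∀ u ∈ Ω, Function.Injective (fderiv ℝ G u)) (k : V → ℂ) :
    ∫ y in G '' Ω, k y ∂Measure.euclideanHausdorffMeasure (Module.finrank ℝ U) =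
      ∫ u in Ω, (fderiv ℝ G u : U →ₗ[ℝ] V).normDet • k (G u) := by
  have hemb : MeasurableEmbedding (Ω.domRestrict G) :=
    hG.continuousOn.measurableEmbedding hΩ.measurableSet hinj
  rw [← map_domRestrict_withDensity_normDet hΩ hG hinj hder, hemb.integral_map]
  simp only [Set.domRestrict_apply, ← Function.comp_apply (f := k), ENNReal.ofReal]
  rw [← (MeasurableEmbedding.subtype_coe hΩ.measurableSet).integral_map
      (g := fun u => (k ∘ G) u), map_comap_subtype_coe hΩ.measurableSet,
    setIntegral_withDensity_eq_setIntegral_smul₀ _ _ hΩ.measurableSet]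
  · congr with x
    rw [NNReal.smul_def, Real.coe_toNNReal _ (LinearMap.normDet_nonneg _)]
  · have hc : ContinuousOn (fun u => (fderiv ℝ G u : U →ₗ[ℝ] V).normDet) Ω :=
      continuous_normDet.comp_continuousOn (hG.continuousOn_fderiv_of_isOpen hΩ le_rfl)
    exact (hc.aemeasurable hΩ.measurableSet).real_toNNReal

end AreaFormula

/-! ### Push-forward of continuous densities under submersions -/

section Submersion

theorem ContinuousOn.continuous_of_eq_zero_off_compact {X E : Type*} [TopologicalSpace X]
    [T2Space X] [TopologicalSpace E] [Zero E] {f : X → E} {s K : Set X} (hf : ContinuousOn f s)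
    (hs : IsOpen s) (hK : IsCompact K) (hKs : K ⊆ s) (h0 : ∀ x ∉ K, f x = 0) :
    Continuous f ∧ HasCompactSupport f ∧ tsupport f ⊆ K := by
  have ht : tsupport f ⊆ K :=
    closure_minimal (fun x hx => by_contra fun hxK => hx (h0 x hxK)) hK.isClosed
  exact ⟨hf.continuous_of_tsupport_subset hs (ht.trans hKs),
    hK.of_isClosed_subset (isClosed_tsupport f) ht, ht⟩

theorem IsCompact.exists_partition_subordinate {X : Type*} [TopologicalSpace X] [T2Space X]
    [LocallyCompactSpace X] {K : Set X} (hK : IsCompact K) {p : Set X → Prop}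
    (h : ∀ x ∈ K, ∃ V, IsOpen V ∧ x ∈ V ∧ p V) :
    ∃ (n : ℕ) (χ : Fin n → C(X, ℝ)), (∀ i, ∃ V, IsOpen V ∧ p V ∧ tsupport (χ i) ⊆ V) ∧
      ∀ x ∈ K, ∑ i, χ i x = 1 := by
  choose! V hVo hxV hpV using h
  obtain ⟨t, htK, hcov⟩ := hK.elim_nhds_subcover V fun x hx => (hVo x hx).mem_nhds (hxV x hx)
  obtain ⟨χ, hχ, hsum, -, -⟩ := exists_continuous_sum_one_of_isOpen_isCompact
    (s := fun i : Fin t.card => V (t.equivFin.symm i))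
    (fun i => hVo _ (htK _ (t.equivFin.symm i).2)) hK (fun x hx => by
      have := hcov hx
      simp only [Set.mem_iUnion] at this ⊢
      obtain ⟨y, hy, hxy⟩ := this
      exact ⟨t.equivFin ⟨y, hy⟩, by simpa using hxy⟩)
  refine ⟨t.card, χ, fun i => ⟨_, hVo _ (htK _ (t.equivFin.symm i).2),
    hpV _ (htK _ (t.equivFin.symm i).2), hχ i⟩, fun x hx => ?_⟩
  simpa using hsum hx

variable {X Y : Type*} [NormedAddCommGroup X] [NormedSpace ℝ X] [FiniteDimensional ℝ X]
  [NormedAddCommGroup Y] [NormedSpace ℝ Y] [FiniteDimensional ℝ Y]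

theorem exists_openPartialHomeomorph_contDiffOn_symm {T : X → X} {Ω : Set X} (hΩ : IsOpen Ω)
    (hT : ContDiffOn ℝ 1 T Ω) {x : X} (hx : x ∈ Ω)
    (hd : HasFDerivAt T (ContinuousLinearMap.id ℝ X) x) :
    ∃ e : OpenPartialHomeomorph X X, ⇑e = T ∧ x ∈ e.source ∧ e.source ⊆ Ω ∧
      ContDiffOn ℝ 1 e.symm e.target := by
  have : CompleteSpace X := FiniteDimensional.complete ℝ X
  have hTx := hT.contDiffAt (hΩ.mem_nhds hx)
  have hd' : HasFDerivAt T ((ContinuousLinearEquiv.refl ℝ X : X ≃L[ℝ] X) : X →L[ℝ] X) x := hd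
  set e₀ := hTx.toOpenPartialHomeomorph T hd' (by simp)
  -- Shrinking to the open set where the derivative is invertible makes the local inverse C¹ on the
  -- whole target, not merely at the image of `x`.
  set O : Set X := Ω ∩ fderiv ℝ T ⁻¹' Set.range ((↑) : (X ≃L[ℝ] X) → X →L[ℝ] X)
  have hO : IsOpen O := (hT.continuousOn_fderiv_of_isOpen hΩ le_rfl).isOpen_inter_preimage hΩ
    ContinuousLinearEquiv.isOpen
  refine ⟨e₀.restrOpen O hO, rfl, ⟨hTx.mem_toOpenPartialHomeomorph_source hd' (by simp), hx, ?_⟩,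
    fun y hy => hy.2.1, fun w hw => ?_⟩
  · exact ⟨ContinuousLinearEquiv.refl ℝ X, hd'.fderiv.symm⟩
  · have hmem : (e₀.restrOpen O hO).symm w ∈ (e₀.restrOpen O hO).source :=
      (e₀.restrOpen O hO).map_target hw
    obtain ⟨hyΩ, f', hf'⟩ := hmem.2
    have hcd : ContDiffAt ℝ 1 T ((e₀.restrOpen O hO).symm w) :=
      hT.contDiffAt (hΩ.mem_nhds hyΩ)
    refine ((e₀.restrOpen O hO).contDiffAt_symm (f₀' := f') hw ?_ hcd).contDiffWithinAt
    rw [hf']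
    exact (hcd.differentiableAt (by simp)).hasFDerivAt

variable [MeasurableSpace X] [BorelSpace X] [MeasurableSpace Y] [BorelSpace Y]

/-- Change of variables: the new density is the Jacobian of `e.symm` times `F ∘ e.symm`, extended by
zero, and it stays continuous because its support is compact inside the target. -/
theorem exists_density_comp_openPartialHomeomorph (μ : Measure X) [μ.IsAddHaarMeasure]
    {e : OpenPartialHomeomorph X X} (he : ContDiffOn ℝ 1 e.symm e.target) {F : X → ℂ}
    (hF : Continuous F) (hFc : HasCompactSupport F) (hFe : tsupport F ⊆ e.source) :
    ∃ H : X → ℂ, Continuous H ∧ HasCompactSupport H ∧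
      ∀ q : X → ℂ, ∫ x, F x * q (e x) ∂μ = ∫ w, H w * q w ∂μ := by
  classical
  set H : X → ℂ := e.target.indicator fun w => |(fderiv ℝ e.symm w).det| • F (e.symm w) with hH
  have hK : IsCompact (e '' tsupport F) := hFc.isCompact.image_of_continuousOn
    (e.continuousOn.mono hFe)
  have hKt : e '' tsupport F ⊆ e.target := by
    rintro _ ⟨x, hx, rfl⟩
    exact e.map_source (hFe hx)
  have hHc : ContinuousOn H e.target := by
    have : ContinuousOn (fun w => |(fderiv ℝ e.symm w).det| • F (e.symm w)) e.target := by
      have hdet : ContinuousOn (fun w => (fderiv ℝ e.symm w).det) e.target :=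
        ContinuousLinearMap.continuous_det.comp_continuousOn
          (he.continuousOn_fderiv_of_isOpen e.open_target le_rfl)
      exact hdet.abs.smul (hF.comp_continuousOn e.symm.continuousOn)
    exact this.congr fun w hw => Set.indicator_of_mem hw _
  obtain ⟨h1, h2, -⟩ := hHc.continuous_of_eq_zero_off_compact e.open_target hK hKt fun w hw => by
    by_cases hwt : w ∈ e.target
    · rw [hH, Set.indicator_of_mem hwt]
      have : F (e.symm w) = 0 := by
        by_contra hne
        exact hw ⟨e.symm w, subset_tsupport F hne, e.right_inv hwt⟩
      rw [this, smul_zero]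
    · exact Set.indicator_of_notMem hwt _
  refine ⟨H, h1, h2, fun q => ?_⟩
  have hcv := integral_target_eq_integral_abs_det_fderiv_smul μ (f := e.symm)
    (f' := fderiv ℝ e.symm) (fun w hw => ((he.contDiffAt
      (e.open_target.mem_nhds hw)).differentiableAt (by simp)).hasFDerivAt)
    fun x => F x * q (e x)
  simp only [OpenPartialHomeomorph.symm_target, OpenPartialHomeomorph.symm_source] at hcv
  rw [← setIntegral_eq_integral_of_forall_compl_eq_zero (s := e.source) (fun x hx => by
      rw [image_eq_zero_of_notMem_tsupport fun h => hx (hFe h), zero_mul]), hcv,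
    ← integral_indicator e.open_target.measurableSet]
  congr 1 with w
  by_cases hwt : w ∈ e.target
  · rw [Set.indicator_of_mem hwt, hH, Set.indicator_of_mem hwt, e.right_inv hwt,
      smul_mul_assoc]
  · rw [Set.indicator_of_notMem hwt, hH, Set.indicator_of_notMem hwt, zero_mul]

/-- A right inverse splits `X` as `Y × ker A`. Uniqueness of Haar measure makes `μ` a multiple of
the product measure, and Fubini gives the density as the integral of `H` over the fibres. -/
theorem exists_density_of_surjective_linear (μ : Measure X) [μ.IsAddHaarMeasure]
    (ν : Measure Y) [ν.IsAddHaarMeasure] {A : X →L[ℝ] Y} {R : Y →L[ℝ] X}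
    (hAR : Function.RightInverse R A) {H : X → ℂ} (hH : Continuous H)
    (hHc : HasCompactSupport H) :
    ∃ h : Y → ℂ, Continuous h ∧ HasCompactSupport h ∧
      ∀ ψ : Y → ℂ, Continuous ψ → ∫ x, H x * ψ (A x) ∂μ = ∫ y, h y * ψ y ∂ν := by
  set L : X ≃L[ℝ] Y × A.ker := ContinuousLinearEquiv.equivOfRightInverse A R hAR
  set κ : Measure A.ker := Measure.addHaar
  have hfst : ∀ x, (L x).1 = A x := fun x => rfl
  set m : Measure X := (ν.prod κ).map L.symm
  have hm : m.IsAddHaarMeasure := L.symm.isAddHaarMeasure_map _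
  set c : ℝ≥0 := μ.addHaarScalarFactor m
  have hμ : μ = c • m := Measure.isAddLeftInvariant_eq_smul μ m
  set G : Y → A.ker → ℂ := fun y k => (c : ℝ) • H (L.symm (y, k))
  have hG : Continuous (Function.uncurry G) := by
    have : Continuous fun p : Y × A.ker => H (L.symm p) := hH.comp L.symm.continuous
    exact this.const_smul (c : ℝ)
  set Q : Set (Y × A.ker) := L '' tsupport H
  have hQ : IsCompact Q := hHc.isCompact.image L.continuous
  have hG0 : ∀ y k, (y, k) ∉ Q → G y k = 0 := by
    intro y k hyk
    have : H (L.symm (y, k)) = 0 := by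
      by_contra hne
      exact hyk ⟨_, subset_tsupport H hne, by simp⟩
    simp only [G, this, smul_zero]
  have hGsupp : HasCompactSupport (Function.uncurry G) :=
    HasCompactSupport.intro hQ fun p hp => hG0 p.1 p.2 hp
  have hh : ∀ y, ∫ k, G y k ∂κ = ∫ k in Prod.snd '' Q, G y k ∂κ := fun y =>
    (setIntegral_eq_integral_of_forall_compl_eq_zero fun k hk =>
      hG0 y k fun hyk => hk (Set.mem_image_of_mem Prod.snd hyk)).symm
  refine ⟨fun y => ∫ k, G y k ∂κ, ?_, ?_, fun ψ hψ => ?_⟩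
  · simp_rw [hh]
    exact continuous_parametric_integral_of_continuous hG (hQ.image continuous_snd)
  · refine HasCompactSupport.intro (hQ.image continuous_fst) fun y hy => ?_
    have : ∀ k, G y k = 0 := fun k => hG0 y k fun hyk => hy (Set.mem_image_of_mem Prod.fst hyk)
    simp [this]
  · have hGψ : Integrable (fun p : Y × A.ker => G p.1 p.2 * ψ p.1) (ν.prod κ) := by
      refine Continuous.integrable_of_hasCompactSupport (hG.mul (hψ.comp continuous_fst)) ?_
      exact hGsupp.mul_right
    calc ∫ x, H x * ψ (A x) ∂μ = (c : ℝ) • ∫ x, H x * ψ (A x) ∂m := by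
          rw [hμ, integral_smul_nnreal_measure]; rfl
      _ = (c : ℝ) • ∫ p, H (L.symm p) * ψ p.1 ∂(ν.prod κ) := by
          have hemb : MeasurableEmbedding L.symm :=
            L.symm.toHomeomorph.measurableEmbedding
          rw [show m = (ν.prod κ).map L.symm from rfl, hemb.integral_map]
          congr 2 with p
          simp [← hfst]
      _ = ∫ p, G p.1 p.2 * ψ p.1 ∂(ν.prod κ) := by
          rw [← integral_smul]
          congr 1 with p
          simp only [G, Prod.mk.eta, smul_mul_assoc]
      _ = _ := by
          rw [integral_prod _ hGψ]
          congr 1 with y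
          exact integral_mul_const (ψ y) (G y)

/-- The image of a continuous compactly supported density under a submersion of class `C¹` is
again a continuous compactly supported density. -/
theorem exists_density_of_submersion (μ : Measure X) [μ.IsAddHaarMeasure]
    (ν : Measure Y) [ν.IsAddHaarMeasure] {P : X → Y} {Ω : Set X} (hΩ : IsOpen Ω)
    (hP : ContDiffOn ℝ 1 P Ω) (hsurj : ∀ x ∈ Ω, Function.Surjective (fderiv ℝ P x)) {F : X → ℂ}
    (hF : Continuous F) (hFc : HasCompactSupport F) (hFΩ : tsupport F ⊆ Ω) :
    ∃ h : Y → ℂ, Continuous h ∧ HasCompactSupport h ∧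
      ∀ ψ : Y → ℂ, Continuous ψ → ∫ x, F x * ψ (P x) ∂μ = ∫ y, h y * ψ y ∂ν := by
  have hloc : ∀ x ∈ tsupport F, ∃ V, IsOpen V ∧ x ∈ V ∧ (V ⊆ Ω ∧ ∀ F : X → ℂ, Continuous F →
      HasCompactSupport F → tsupport F ⊆ V → ∃ h : Y → ℂ, Continuous h ∧ HasCompactSupport h ∧
      ∀ ψ : Y → ℂ, Continuous ψ → ∫ x, F x * ψ (P x) ∂μ = ∫ y, h y * ψ y ∂ν) := by
    intro x hx
    have hxΩ := hFΩ hx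
    set A := fderiv ℝ P x
    obtain ⟨R, hR⟩ := A.exists_rightInverse_of_surjective
      (LinearMap.range_eq_top.2 (hsurj x hxΩ))
    have hAR : Function.RightInverse R A := fun y => DFunLike.congr_fun hR y
    -- Since `A ∘ R = id`, one has `A ∘ T = P`, and the derivative of `T` at `x` is the identity:
    -- `T` straightens `P` to its linear part.
    set T : X → X := fun z => z + R (P z - A z) with hT
    have hTc : ContDiffOn ℝ 1 T Ω :=
      contDiffOn_id.add (R.contDiff.comp_contDiffOn (hP.sub A.contDiff.contDiffOn))
    have hd : HasFDerivAt T (ContinuousLinearMap.id ℝ X) x := by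
      have h1 : HasFDerivAt P A x :=
        ((hP.contDiffAt (hΩ.mem_nhds hxΩ)).differentiableAt (by simp)).hasFDerivAt
      have := (hasFDerivAt_id x).add
        (R.hasFDerivAt.comp x (h1.sub A.hasFDerivAt))
      rw [sub_self, ContinuousLinearMap.comp_zero, add_zero] at this
      exact this
    obtain ⟨e, heT, hxe, heΩ, hes⟩ := exists_openPartialHomeomorph_contDiffOn_symm hΩ hTc hxΩ hd
    refine ⟨e.source, e.open_source, hxe, heΩ, fun F hF hFc hFe => ?_⟩
    obtain ⟨H, hH, hHc, hHi⟩ := exists_density_comp_openPartialHomeomorph μ hes hF hFc hFe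
    obtain ⟨h, hh, hhc, hhi⟩ := exists_density_of_surjective_linear μ ν hAR hH hHc
    refine ⟨h, hh, hhc, fun ψ hψ => ?_⟩
    rw [← hhi ψ hψ, ← hHi fun w => ψ (A w)]
    congr 1 with z
    rw [heT, hT]
    simp only [map_add, hAR (P z - A z), add_sub_cancel]
  obtain ⟨n, χ, hχ, hsum⟩ := hFc.isCompact.exists_partition_subordinate hloc
  choose V hVo hV hχV using hχ
  have hts : ∀ i, tsupport (fun x => (χ i x : ℂ) * F x) ⊆ tsupport (χ i) := fun i =>
    closure_mono fun x hx => by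
      simp only [Function.mem_support] at hx ⊢
      intro h0
      simp [h0] at hx
  have hcont : ∀ i, Continuous fun x => (χ i x : ℂ) * F x := fun i =>
    (Complex.continuous_ofReal.comp (χ i).continuous).mul hF
  have hcs : ∀ i, HasCompactSupport fun x => (χ i x : ℂ) * F x := fun i => hFc.mul_left
  choose h hh hhc hhi using fun i => (hV i).2 (fun x => (χ i x : ℂ) * F x) (hcont i) (hcs i)
    ((hts i).trans (hχV i))
  refine ⟨fun y => ∑ i, h i y, continuous_finsetSum _ fun i _ => hh i, ?_, fun ψ hψ => ?_⟩
  · refine HasCompactSupport.intro (isCompact_iUnion fun i => (hhc i).isCompact) fun y hy => ?_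
    simp only [Set.mem_iUnion, not_exists] at hy
    exact Finset.sum_eq_zero fun i _ => image_eq_zero_of_notMem_tsupport (hy i)
  · have h1 : ∀ x, F x * ψ (P x) = ∑ i, (χ i x : ℂ) * F x * ψ (P x) := by
      intro x
      rw [← Finset.sum_mul, ← Finset.sum_mul]
      by_cases hx : x ∈ tsupport F
      · have : ∑ i, (χ i x : ℂ) = 1 := by exact_mod_cast hsum x hx
        rw [this, one_mul]
      · simp [image_eq_zero_of_notMem_tsupport hx]
    simp_rw [h1, Finset.sum_mul]
    rw [integral_finsetSum, integral_finsetSum]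
    · exact Finset.sum_congr rfl fun i _ => hhi i ψ hψ
    · intro i _
      exact Continuous.integrable_of_hasCompactSupport ((hh i).mul hψ) (hhc i).mul_right
    · intro i _
      have hcO : ContinuousOn (fun x => (χ i x : ℂ) * F x * ψ (P x)) Ω :=
        (hcont i).continuousOn.mul (hψ.comp_continuousOn hP.continuousOn)
      obtain ⟨h2, h3, -⟩ := hcO.continuous_of_eq_zero_off_compact hΩ (hcs i).isCompact
        (((hts i).trans (hχV i)).trans (hV i).1) fun x hx => by
          rw [image_eq_zero_of_notMem_tsupport hx, zero_mul]
      exact h2.integrable_of_hasCompactSupport h3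

end Submersion

/-! ### Surface pieces: measurability and growth of the surface measure -/

section SurfacePiece

/-- The Euclidean plane. -/
abbrev E2 : Type := EuclideanSpace ℝ (Fin 2)

theorem exists_linearIsometry_range_eq_orthogonal {v : E3} (hv : v ≠ 0) :
    ∃ ι : E2 →ₗᵢ[ℝ] E3, ∀ x, (∃ u, ι u = x) ↔ inner ℝ v x = 0 := by
  have : Fact (Module.finrank ℝ E3 = 2 + 1) := ⟨by simp⟩
  set b := OrthonormalBasis.fromOrthogonalSpanSingleton (𝕜 := ℝ) 2 hv
  refine ⟨(Submodule.subtypeₗᵢ _).comp b.repr.symm.toLinearIsometry, fun x => ?_⟩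
  rw [← Submodule.mem_orthogonal_singleton_iff_inner_right (𝕜 := ℝ)]
  constructor
  · rintro ⟨u, rfl⟩
    exact (b.repr.symm u).2
  · intro hx
    exact ⟨b.repr ⟨x, hx⟩, by simp⟩

/-- Here `p` is the orthogonal projection onto the plane normal to `v`, in isometric coordinates;
the component it loses is exactly `inner ℝ v x`. -/
theorem exists_plane_projection {v : E3} (hv : ‖v‖ = 1) :
    ∃ p : E3 →L[ℝ] E2, ‖p‖ ≤ 1 ∧ ∀ x, ‖x‖ ≤ ‖p x‖ + |inner ℝ v x| := by
  obtain ⟨ι, hι⟩ := exists_linearIsometry_range_eq_orthogonal (v := v) (by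
    rintro rfl
    simp at hv)
  refine ⟨ContinuousLinearMap.adjoint ι.toContinuousLinearMap, ?_, fun x => ?_⟩
  · rw [LinearIsometryEquiv.norm_map]
    exact ι.norm_toContinuousLinearMap_le
  · obtain ⟨u, hu⟩ := (hι (x - inner ℝ v x • v)).2 (by
      rw [inner_sub_right, inner_smul_right, real_inner_self_eq_norm_sq, hv]; ring)
    have hιv : ContinuousLinearMap.adjoint ι.toContinuousLinearMap v = 0 := by
      refine ext_inner_right ℝ fun w => ?_
      rw [ContinuousLinearMap.adjoint_inner_left, inner_zero_left]
      exact (hι _).1 ⟨w, rfl⟩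
    have hx : x = ι u + inner ℝ v x • v := by rw [hu]; abel
    have hpx : ContinuousLinearMap.adjoint ι.toContinuousLinearMap x = u := by
      refine ext_inner_right ℝ fun w => ?_
      rw [ContinuousLinearMap.adjoint_inner_left, hx, inner_add_left, inner_smul_left]
      have h0 : inner ℝ v (ι.toContinuousLinearMap w) = 0 := (hι _).1 ⟨w, rfl⟩
      rw [h0, mul_zero, add_zero]
      exact ι.inner_map_map u w
    rw [hpx]
    calc ‖x‖ = ‖ι u + inner ℝ v x • v‖ := by rw [← hx]
      _ ≤ ‖ι u‖ + ‖inner ℝ v x • v‖ := norm_add_le _ _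
      _ = _ := by rw [ι.norm_map, norm_smul, hv, mul_one, Real.norm_eq_abs]

theorem inner_gradient_eq_fderiv (Φ : E3 → ℝ) (x v : E3) :
    inner ℝ (gradient Φ x) v = fderiv ℝ Φ x v :=
  InnerProductSpace.toDual_symm_apply

theorem gradient_eq_zero_iff {Φ : E3 → ℝ} {x : E3} : gradient Φ x = 0 ↔ fderiv ℝ Φ x = 0 := by
  simp [gradient]

theorem isOpen_inter_gradient_ne_zero {U : Set E3} {Φ : E3 → ℝ} (hU : IsOpen U)
    (hΦ : ContDiffOn ℝ 1 Φ U) : IsOpen (U ∩ {x | gradient Φ x ≠ 0}) := by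
  have h : {x | gradient Φ x ≠ 0} = fderiv ℝ Φ ⁻¹' {0}ᶜ := by
    ext x
    simp [gradient_eq_zero_iff]
  rw [h]
  exact (hΦ.continuousOn_fderiv_of_isOpen hU le_rfl).isOpen_inter_preimage hU
    isOpen_compl_singleton

theorem isLocallyClosed_levelSurface {U : Set E3} {Φ : E3 → ℝ} (hU : IsOpen U)
    (hΦ : ContDiffOn ℝ 1 Φ U) : IsLocallyClosed (levelSurface U Φ) := by
  obtain ⟨u, hu, hus⟩ := continuousOn_iff_isClosed.1 hΦ.continuousOn {0} isClosed_singleton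
  refine ⟨U ∩ {x | gradient Φ x ≠ 0}, u, isOpen_inter_gradient_ne_zero hU hΦ, hu, ?_⟩
  ext x
  have := Set.ext_iff.1 hus x
  simp only [levelSurface, Set.mem_inter_iff, Set.mem_preimage, Set.mem_singleton_iff,
    Set.mem_ofPred_eq] at this ⊢
  tauto

variable {β : ℝ≥0} {S U : Set E3} {Φ : E3 → ℝ} {n : E3 → E3}

theorem IsSurfacePiece.isLocallyClosed {b : ℝ} (h : IsSurfacePiece β b S U Φ n) :
    IsLocallyClosed S := by
  obtain ⟨V, hV, rfl⟩ := h.relOpen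
  exact (isLocallyClosed_levelSurface h.isOpen_U h.regular.1).inter hV.isLocallyClosed

theorem IsLocallyClosed.measurableSet {S : Set E3} (h : IsLocallyClosed S) : MeasurableSet S := by
  obtain ⟨u, z, hu, hz, rfl⟩ := h
  exact hu.measurableSet.inter hz.measurableSet

theorem IsSurfacePiece.subset_levelSurface {b : ℝ} (h : IsSurfacePiece β b S U Φ n) :
    S ⊆ levelSurface U Φ := by
  obtain ⟨V, -, rfl⟩ := h.relOpen
  exact Set.inter_subset_left

theorem IsSurfacePiece.norm_normal_sub_le (h : IsSurfacePiece β 1 S U Φ n) {σ τ : E3}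
    (hσ : σ ∈ levelSurface U Φ) (hτ : τ ∈ levelSurface U Φ) :
    ‖n σ - n τ‖ ≤ ‖σ - τ‖ ^ (β : ℝ) := by
  rcases eq_or_ne σ τ with rfl | hne
  · simp only [sub_self, norm_zero]
    positivity
  have hpos : 0 < ‖σ - τ‖ := norm_pos_iff.2 (sub_ne_zero.2 hne)
  have h1 := h.holder σ hσ τ hτ hne
  have h2 : 0 ≤ |inner ℝ (n σ) (σ - τ)| / ‖σ - τ‖ ^ (1 + (β : ℝ)) := by positivity
  have h3 : ‖n σ - n τ‖ / ‖σ - τ‖ ^ (β : ℝ) ≤ 1 := by linarith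
  rwa [div_le_one (by positivity)] at h3

theorem IsSurfacePiece.abs_inner_normal_sub_le (h : IsSurfacePiece β 1 S U Φ n) {σ τ : E3}
    (hσ : σ ∈ levelSurface U Φ) (hτ : τ ∈ levelSurface U Φ) :
    |inner ℝ (n σ) (σ - τ)| ≤ ‖σ - τ‖ ^ (β : ℝ) * ‖σ - τ‖ := by
  rcases eq_or_ne σ τ with rfl | hne
  · simp
  have hpos : 0 < ‖σ - τ‖ := norm_pos_iff.2 (sub_ne_zero.2 hne)
  have h1 := h.holder σ hσ τ hτ hne
  have h2 : 0 ≤ ‖n σ - n τ‖ / ‖σ - τ‖ ^ (β : ℝ) := by positivity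
  have h3 : |inner ℝ (n σ) (σ - τ)| / ‖σ - τ‖ ^ (1 + (β : ℝ)) ≤ 1 := by linarith
  rw [div_le_one (by positivity), add_comm, Real.rpow_add_one hpos.ne'] at h3
  exact h3

theorem exists_rpow_le (hβ : 0 < β) {a : ℝ} (ha : 0 < a) :
    ∃ r : ℝ, 0 < r ∧ ∀ t, 0 ≤ t → t ≤ r → t ^ (β : ℝ) ≤ a := by
  have hβpos : (0 : ℝ) < β := hβ
  refine ⟨a ^ (β : ℝ)⁻¹, by positivity, fun t ht htr => ?_⟩
  calc t ^ (β : ℝ) ≤ (a ^ (β : ℝ)⁻¹) ^ (β : ℝ) := Real.rpow_le_rpow ht htr hβpos.le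
    _ = a := by rw [Real.rpow_inv_rpow ha.le (ne_of_gt hβpos)]

/-- The surface measure of a ball of small radius `r` is at most `M * r ^ 2`, with constants that
depend only on the Hölder exponent. -/
theorem exists_surfaceMeasure_closedBall_le (hβ : 0 < β) :
    ∃ r₀ : ℝ, 0 < r₀ ∧ ∃ M : ℝ≥0, ∀ (S U : Set E3) (Φ : E3 → ℝ) (n : E3 → E3),
      IsSurfacePiece β 1 S U Φ n → ∀ (p : E3) (r : ℝ), 0 ≤ r → r ≤ r₀ →
        surfaceMeasure S (Metric.closedBall p r) ≤ M * ENNReal.ofReal r ^ 2 := by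
  -- One quarter pays for the deviation of `x - y` from the tangent plane at `x`, another for the
  -- change of normal from `x` to `σ`. Together they leave the projection along `n σ` with a
  -- 2-Lipschitz inverse on the piece.
  obtain ⟨R, hR, hRβ⟩ := exists_rpow_le hβ (a := 1 / 4) (by norm_num)
  have hfin : (volume (Metric.ball (0 : E2) 1)) ≠ ⊤ := measure_ball_lt_top.ne
  -- The 16 is `2 ^ 2` from the Lipschitz constant times `2 ^ 2` from the radius `2 * r` of the disc
  -- containing the projection.
  refine ⟨R / 4, by positivity, 16 * (volume (Metric.ball (0 : E2) 1)).toNNReal,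
    fun S U Φ n h p r hr hrR => ?_⟩
  rw [surfaceMeasure, Measure.restrict_apply measurableSet_closedBall]
  rcases (Metric.closedBall p r ∩ S).eq_empty_or_nonempty with he | ⟨σ, hσp, hσ⟩
  · simp [he]
  set B := Metric.closedBall p r ∩ S
  have hσ' := h.subset_levelSurface hσ
  obtain ⟨π, hπ1, hπ⟩ := exists_plane_projection (h.norm_normal σ hσ')
  have hdist : ∀ x ∈ B, ∀ y ∈ B, ‖x - y‖ ≤ 2 * r := by
    intro x hx y hy
    rw [← dist_eq_norm]
    calc dist x y ≤ dist x p + dist y p := dist_triangle_right _ _ _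
      _ ≤ r + r := add_le_add hx.1 hy.1
      _ = _ := by ring
  have hσB : σ ∈ B := ⟨hσp, hσ⟩
  have hlip : ∀ x ∈ B, ∀ y ∈ B, ‖x - y‖ ≤ 2 * ‖π x - π y‖ := by
    intro x hx y hy
    have hxS := h.subset_levelSurface hx.2
    have h1 := h.abs_inner_normal_sub_le hxS (h.subset_levelSurface hy.2)
    have h2 := h.norm_normal_sub_le hσ' hxS
    have h3 := hRβ ‖x - y‖ (norm_nonneg _) ((hdist x hx y hy).trans (by linarith))
    have h4 := hRβ ‖σ - x‖ (norm_nonneg _) ((hdist σ hσB x hx).trans (by linarith))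
    have h5 : |inner ℝ (n σ) (x - y)| ≤ 1 / 2 * ‖x - y‖ := by
      have : inner ℝ (n σ) (x - y) = inner ℝ (n x) (x - y) + inner ℝ (n σ - n x) (x - y) := by
        rw [inner_sub_left]; ring
      rw [this]
      have h6 := abs_real_inner_le_norm (n σ - n x) (x - y)
      have h7 : ‖n σ - n x‖ * ‖x - y‖ ≤ 1 / 4 * ‖x - y‖ := by gcongr; linarith
      have h8 : ‖x - y‖ ^ (β : ℝ) * ‖x - y‖ ≤ 1 / 4 * ‖x - y‖ := by gcongr
      have h9 := abs_add_le (inner ℝ (n x) (x - y)) (inner ℝ (n σ - n x) (x - y))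
      linarith
    have h6 := hπ (x - y)
    rw [map_sub] at h6
    linarith
  have himg := euclideanHausdorffMeasure_image_le_of_edist_le 2 (f := id) (g := π) (K := 2)
    (B := B) fun x hx y hy => by
      have := hlip x hx y hy
      rw [edist_dist, edist_dist, ← ENNReal.ofReal_coe_nnreal,
        ← ENNReal.ofReal_mul (NNReal.coe_nonneg _), dist_eq_norm, dist_eq_norm]
      exact ENNReal.ofReal_le_ofReal this
  rw [Set.image_id, EuclideanSpace.euclideanHausdorffMeasure_eq_volume] at himg
  have hsub : π '' B ⊆ Metric.closedBall (π σ) (2 * r) := by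
    rintro _ ⟨x, hx, rfl⟩
    rw [mem_closedBall_iff_norm, ← map_sub]
    calc ‖π (x - σ)‖ ≤ ‖π‖ * ‖x - σ‖ := π.le_opNorm _
      _ ≤ 1 * ‖x - σ‖ := by gcongr
      _ ≤ 2 * r := by rw [one_mul]; exact hdist x hx σ hσB
  calc _ ≤ _ := himg
    _ ≤ ((2 : ℝ≥0) : ℝ≥0∞) ^ 2 * volume (Metric.closedBall (π σ) (2 * r)) := by gcongr
    _ = _ := by
      rw [Measure.addHaar_closedBall _ _ (by positivity), ENNReal.coe_mul,
        ENNReal.coe_toNNReal hfin, finrank_euclideanSpace_fin,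
        ENNReal.ofReal_pow (by positivity), ENNReal.ofReal_mul (by norm_num)]
      simp only [ENNReal.ofReal_ofNat, ENNReal.coe_ofNat]
      ring

theorem IsSurfacePiece.isFiniteMeasure (hβ : 0 < β) (h : IsSurfacePiece β 1 S U Φ n) :
    IsFiniteMeasure (surfaceMeasure S) := by
  obtain ⟨r, hr, M, hM⟩ := exists_surfaceMeasure_closedBall_le hβ
  constructor
  have htb : TotallyBounded S :=
    (Bornology.IsBounded.isCompact_closure h.bounded).totallyBounded.subset subset_closure
  obtain ⟨t, htf, hcov⟩ := Metric.totallyBounded_iff.1 htb r hr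
  have : surfaceMeasure S Set.univ = surfaceMeasure S S := by
    rw [surfaceMeasure, Measure.restrict_apply_univ, Measure.restrict_apply_self]
  rw [this]
  refine (measure_mono hcov).trans_lt ((measure_biUnion_lt_top htf fun p _ => ?_))
  refine (measure_mono Metric.ball_subset_closedBall).trans_lt
    ((hM S U Φ n h p r hr.le le_rfl).trans_lt ?_)
  exact ENNReal.mul_lt_top ENNReal.coe_lt_top (by simp)

end SurfacePiece

/-! ### Charts of level surfaces and continuity of convolutions -/

section Charts

variable {U V : Set E3} {Φ : E3 → ℝ}

/-- The orthogonal complement of a tangent plane is a line. Hence a vector normal to both charts is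
a multiple of both gradients. -/
theorem exists_eq_smul_of_orthogonal_range {A : E2 →L[ℝ] E3} (hA : Function.Injective A) {v w : E3}
    (hv : v ≠ 0) (hvA : ∀ a, inner ℝ v (A a) = 0) (hwA : ∀ a, inner ℝ w (A a) = 0) :
    ∃ c : ℝ, c • v = w := by
  set R : Submodule ℝ E3 := (A : E2 →ₗ[ℝ] E3).range
  have hR : Module.finrank ℝ R = 2 := by
    rw [LinearMap.finrank_range_of_inj hA]
    simp
  have hRo : Module.finrank ℝ Rᗮ = 1 := by
    have := R.finrank_add_finrank_orthogonal
    rw [hR, finrank_euclideanSpace_fin] at this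
    omega
  have hmem : ∀ z : E3, (∀ a, inner ℝ z (A a) = 0) → z ∈ Rᗮ := by
    intro z hz
    rw [Submodule.mem_orthogonal']
    rintro _ ⟨a, rfl⟩
    exact hz a
  obtain ⟨c, hc⟩ := (finrank_eq_one_iff_of_nonzero' (⟨v, hmem v hvA⟩ : Rᗮ)
    (by simpa [Subtype.ext_iff] using hv)).1 hRo ⟨w, hmem w hwA⟩
  exact ⟨c, congrArg Subtype.val hc⟩

/-- Local parametrization of a relatively open subset of a level surface. -/
theorem exists_chart_levelSurface (hU : IsOpen U) (hΦ : ContDiffOn ℝ 1 Φ U) (hV : IsOpen V)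
    {σ : E3} (hσ : σ ∈ levelSurface U Φ ∩ V) :
    ∃ (O : Set E3) (Ω : Set E2) (G : E2 → E3), IsOpen O ∧ σ ∈ O ∧ IsOpen Ω ∧
      ContDiffOn ℝ 1 G Ω ∧ Set.InjOn G Ω ∧ (∀ u ∈ Ω, Function.Injective (fderiv ℝ G u)) ∧
      G '' Ω = levelSurface U Φ ∩ V ∩ O ∧
      (∀ u ∈ Ω, ∀ a, inner ℝ (gradient Φ (G u)) (fderiv ℝ G u a) = 0) ∧
      ∀ K ⊆ levelSurface U Φ ∩ V ∩ O, IsCompact K → IsCompact (Ω ∩ G ⁻¹' K) := by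
  obtain ⟨⟨hσU, hσ0, hσg⟩, hσV⟩ := hσ
  set D : Set E3 := U ∩ {x | gradient Φ x ≠ 0} ∩ V
  have hD : IsOpen D := (isOpen_inter_gradient_ne_zero hU hΦ).inter hV
  have hDU : D ⊆ U := fun x hx => hx.1.1
  have hdiff : ∀ x ∈ D, HasFDerivAt Φ (fderiv ℝ Φ x) x := fun x hx =>
    ((hΦ.contDiffAt (hU.mem_nhds (hDU hx))).differentiableAt (by simp)).hasFDerivAt
  set A : E3 →L[ℝ] ℝ := fderiv ℝ Φ σ
  have hA0 : A ≠ 0 := fun h => hσg (gradient_eq_zero_iff.2 h)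
  obtain ⟨R, hR⟩ := A.exists_rightInverse_of_surjective
    (LinearMap.range_eq_top.2 (LinearMap.surjective (f := (A : E3 →ₗ[ℝ] ℝ))
      fun h => hA0 (ContinuousLinearMap.coe_injective h)))
  have hAR : ∀ t, A (R t) = t := fun t => DFunLike.congr_fun hR t
  -- Again `A ∘ T = Φ`, so `T` flattens the zero set of `Φ` onto part of the plane `ker A`, which
  -- `ι` parametrizes isometrically.
  set T : E3 → E3 := fun z => z + R (Φ z - A z) with hT
  have hTc : ContDiffOn ℝ 1 T D :=
    contDiffOn_id.add (R.contDiff.comp_contDiffOn ((hΦ.mono hDU).sub A.contDiff.contDiffOn))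
  have hσD : σ ∈ D := ⟨⟨hσU, hσg⟩, hσV⟩
  have hd : HasFDerivAt T (ContinuousLinearMap.id ℝ E3) σ := by
    have := (hasFDerivAt_id σ).add
      (R.hasFDerivAt.comp σ ((hdiff σ hσD).sub A.hasFDerivAt))
    rw [sub_self, ContinuousLinearMap.comp_zero, add_zero] at this
    exact this
  have hAT : ∀ z, A (T z) = Φ z := fun z => by
    simp only [hT, map_add, hAR, add_sub_cancel]
  obtain ⟨e, heT, hσe, heD, hes⟩ := exists_openPartialHomeomorph_contDiffOn_symm hD hTc hσD hd
  obtain ⟨ι, hι⟩ := exists_linearIsometry_range_eq_orthogonal hσg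
  simp_rw [inner_gradient_eq_fderiv] at hι
  set Ω : Set E2 := ι ⁻¹' e.target
  set G : E2 → E3 := fun u => e.symm (ι u)
  have hΩ : IsOpen Ω := e.open_target.preimage ι.continuous
  have hGs : ∀ u ∈ Ω, G u ∈ e.source := fun u hu => e.map_target hu
  have hTG : ∀ u ∈ Ω, T (G u) = ι u := fun u hu => by
    rw [← heT]
    exact e.right_inv hu
  have hGc : ContDiffOn ℝ 1 G Ω :=
    hes.comp ι.toContinuousLinearMap.contDiff.contDiffOn fun u hu => hu
  have hGd : ∀ u ∈ Ω, HasFDerivAt G (fderiv ℝ G u) u := fun u hu =>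
    ((hGc.contDiffAt (hΩ.mem_nhds hu)).differentiableAt (by simp)).hasFDerivAt
  have hΦG : ∀ u ∈ Ω, Φ (G u) = 0 := fun u hu => by
    rw [← hAT, hTG u hu]
    exact (hι _).1 ⟨u, rfl⟩
  have himg : G '' Ω = levelSurface U Φ ∩ V ∩ e.source := by
    ext x
    constructor
    · rintro ⟨u, hu, rfl⟩
      have := heD (hGs u hu)
      exact ⟨⟨⟨this.1.1, hΦG u hu, this.1.2⟩, this.2⟩, hGs u hu⟩
    · rintro ⟨⟨⟨hxU, hx0, hxg⟩, hxV⟩, hxe⟩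
      obtain ⟨u, hu⟩ := (hι (e x)).2 (by rw [heT]; exact (hAT x).trans hx0)
      refine ⟨u, ?_, ?_⟩
      · change ι u ∈ e.target
        rw [hu]
        exact e.map_source hxe
      · change e.symm (ι u) = x
        rw [hu, e.left_inv hxe]
  refine ⟨e.source, Ω, G, e.open_source, hσe, hΩ, hGc, ?_, fun u hu => ?_, himg,
    fun u hu a => ?_, fun K hK hKc => ?_⟩
  · intro u hu v hv huv
    apply ι.injective
    rw [← hTG u hu, ← hTG v hv, huv]
  · have hTd : HasFDerivAt T (fderiv ℝ T (G u)) (G u) :=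
      ((hTc.contDiffAt (hD.mem_nhds (heD (hGs u hu)))).differentiableAt (by simp)).hasFDerivAt
    have h1 := hTd.comp u (hGd u hu)
    have h2 : HasFDerivAt (T ∘ G) ι.toContinuousLinearMap u :=
      ι.toContinuousLinearMap.hasFDerivAt.congr_of_eventuallyEq
        (eventually_of_mem (hΩ.mem_nhds hu) hTG)
    have h3 := h1.unique h2
    intro a b hab
    apply ι.injective
    have ha := DFunLike.congr_fun h3 a
    have hb := DFunLike.congr_fun h3 b
    simp only [ContinuousLinearMap.comp_apply] at ha hb
    rw [hab] at ha
    exact ha.symm.trans hb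
  · rw [inner_gradient_eq_fderiv]
    have h1 := (hdiff _ (heD (hGs u hu))).comp u (hGd u hu)
    have h2 : HasFDerivAt (Φ ∘ G) (0 : E2 →L[ℝ] ℝ) u :=
      (hasFDerivAt_const (0 : ℝ) u).congr_of_eventuallyEq
        (eventually_of_mem (hΩ.mem_nhds hu) hΦG)
    exact DFunLike.congr_fun (h1.unique h2) a
  -- Properness of the chart holds because `ι` is a closed embedding; it is what allows a
  -- pulled-back density to be extended by zero continuously.
  · have heq : Ω ∩ G ⁻¹' K = ι ⁻¹' (e '' K) := by
      ext u
      constructor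
      · rintro ⟨hu, huK⟩
        exact ⟨G u, huK, e.right_inv hu⟩
      · rintro ⟨x, hx, hxu⟩
        have hxe := (hK hx).2
        refine ⟨?_, ?_⟩
        · change ι u ∈ e.target
          rw [← hxu]
          exact e.map_source hxe
        · change e.symm (ι u) ∈ K
          rw [← hxu, e.left_inv hxe]
          exact hx
    rw [heq]
    exact ι.isometry.isClosedEmbedding.isCompact_preimage
      (hKc.image_of_continuousOn (e.continuousOn.mono fun x hx => (hK hx).2))

/-- Pull-back of a continuous function on the image of a chart. -/
theorem exists_pullback_density {S O : Set E3} {Ω : Set E2} {G : E2 → E3} (hO : IsOpen O)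
    (hΩ : IsOpen Ω) (hG : ContDiffOn ℝ 1 G Ω) (hinj : Set.InjOn G Ω)
    (hder : ∀ u ∈ Ω, Function.Injective (fderiv ℝ G u)) (himg : G '' Ω = S ∩ O)
    (hprop : ∀ K ⊆ S ∩ O, IsCompact K → IsCompact (Ω ∩ G ⁻¹' K)) {f : E3 → ℂ}
    (hf : ContinuousOn f S) {K : Set E3} (hK : IsCompact K) (hKS : K ⊆ S ∩ O)
    (hfK : ∀ x ∉ K, f x = 0) :
    ∃ F : E2 → ℂ, Continuous F ∧ HasCompactSupport F ∧ tsupport F ⊆ Ω ∧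
      ∀ q : E3 → ℂ, ∫ x, f x * q x ∂surfaceMeasure S = ∫ u, F u * q (G u) := by
  classical
  set F : E2 → ℂ := Ω.indicator fun u => (fderiv ℝ G u : E2 →ₗ[ℝ] E3).normDet • f (G u) with hF
  have hFc : ContinuousOn F Ω := by
    have hc : ContinuousOn (fun u => (fderiv ℝ G u : E2 →ₗ[ℝ] E3).normDet) Ω :=
      continuous_normDet.comp_continuousOn (hG.continuousOn_fderiv_of_isOpen hΩ le_rfl)
    have : ContinuousOn (fun u => (fderiv ℝ G u : E2 →ₗ[ℝ] E3).normDet • f (G u)) Ω :=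
      hc.smul (hf.comp hG.continuousOn fun u hu => (himg.subset ⟨u, hu, rfl⟩ : G u ∈ S ∩ O).1)
    exact this.congr fun u hu => Set.indicator_of_mem hu _
  obtain ⟨h1, h2, h3⟩ := hFc.continuous_of_eq_zero_off_compact hΩ (hprop K hKS hK)
    Set.inter_subset_left fun u hu => by
      by_cases huΩ : u ∈ Ω
      · rw [hF, Set.indicator_of_mem huΩ, hfK _ fun h => hu ⟨huΩ, h⟩, smul_zero]
      · exact Set.indicator_of_notMem huΩ _
  refine ⟨F, h1, h2, h3.trans Set.inter_subset_left, fun q => ?_⟩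
  have harea := setIntegral_image_eq_setIntegral_normDet_smul hΩ hG hinj hder fun x => f x * q x
  rw [finrank_euclideanSpace_fin, himg] at harea
  rw [surfaceMeasure, ← setIntegral_eq_integral_of_forall_compl_eq_zero (s := O) (fun x hx => by
      rw [hfK x fun h => hx (hKS h).2, zero_mul]), Measure.restrict_restrict hO.measurableSet,
    Set.inter_comm, harea, ← integral_indicator hΩ.measurableSet]
  congr 1 with u
  by_cases hu : u ∈ Ω
  · rw [Set.indicator_of_mem hu, hF, Set.indicator_of_mem hu, smul_mul_assoc]
  · rw [Set.indicator_of_notMem hu, hF, Set.indicator_of_notMem hu, zero_mul]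

end Charts

/-! ### Bilinearity and continuity of convolutions of `C_c` densities -/

section Convolution

variable {S₁ S₂ : Set E3}

theorem IsCcOn.zero (S : Set E3) : IsCcOn S 0 :=
  ⟨continuousOn_const, ∅, isCompact_empty, Set.empty_subset _, fun _ _ => rfl⟩

theorem IsCcOn.add {S : Set E3} {f g : E3 → ℂ} (hf : IsCcOn S f) (hg : IsCcOn S g) :
    IsCcOn S (f + g) := by
  obtain ⟨hfc, K, hK, hKS, hfK⟩ := hf
  obtain ⟨hgc, L, hL, hLS, hgL⟩ := hg
  refine ⟨hfc.add hgc, K ∪ L, hK.union hL, Set.union_subset hKS hLS, fun x hx => ?_⟩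
  rw [Set.mem_union, not_or] at hx
  rw [Pi.add_apply, hfK x hx.1, hgL x hx.2, add_zero]

theorem IsCcOn.neg {S : Set E3} {f : E3 → ℂ} (hf : IsCcOn S f) : IsCcOn S (-f) := by
  obtain ⟨hfc, K, hK, hKS, hfK⟩ := hf
  exact ⟨hfc.neg, K, hK, hKS, fun x hx => by rw [Pi.neg_apply, hfK x hx, neg_zero]⟩

theorem IsCcOn.sub {S : Set E3} {f g : E3 → ℂ} (hf : IsCcOn S f) (hg : IsCcOn S g) :
    IsCcOn S (f - g) := by
  rw [sub_eq_add_neg]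
  exact hf.add hg.neg

theorem IsCcOn.aestronglyMeasurable {S : Set E3} (hS : MeasurableSet S) {f : E3 → ℂ}
    (hf : IsCcOn S f) : AEStronglyMeasurable f (surfaceMeasure S) :=
  hf.1.aestronglyMeasurable hS

theorem IsCcOn.exists_norm_le {S : Set E3} {f : E3 → ℂ} (hf : IsCcOn S f) :
    ∃ C, ∀ x, ‖f x‖ ≤ C := by
  obtain ⟨hfc, K, hK, hKS, hfK⟩ := hf
  obtain ⟨C, hC⟩ := hK.exists_bound_of_continuousOn (hfc.mono hKS)
  refine ⟨max C 0, fun x => ?_⟩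
  by_cases hx : x ∈ K
  · exact (hC x hx).trans (le_max_left _ _)
  · rw [hfK x hx, norm_zero]
    exact le_max_right _ _

theorem IsCcOn.integrable {S : Set E3} (hS : MeasurableSet S)
    [IsFiniteMeasure (surfaceMeasure S)] {f : E3 → ℂ} (hf : IsCcOn S f) :
    Integrable f (surfaceMeasure S) := by
  obtain ⟨C, hC⟩ := hf.exists_norm_le
  exact Integrable.of_bound (hf.aestronglyMeasurable hS) C (Eventually.of_forall hC)

theorem IsCcOn.memLp {S : Set E3} (hS : MeasurableSet S)
    [IsFiniteMeasure (surfaceMeasure S)] {f : E3 → ℂ} (hf : IsCcOn S f) :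
    MemLp f 2 (surfaceMeasure S) := by
  obtain ⟨C, hC⟩ := hf.exists_norm_le
  exact MemLp.of_bound (hf.aestronglyMeasurable hS) C (Eventually.of_forall hC)

section Finite

variable [IsFiniteMeasure (surfaceMeasure S₁)] [IsFiniteMeasure (surfaceMeasure S₂)]

theorem IsCcOn.integrable_prod (h₁ : MeasurableSet S₁) (h₂ : MeasurableSet S₂) {f g : E3 → ℂ}
    (hf : IsCcOn S₁ f) (hg : IsCcOn S₂ g) {ψ : E3 → ℂ} (hψ : Continuous ψ)
    (hψc : HasCompactSupport ψ) :
    Integrable (fun p : E3 × E3 => f p.1 * g p.2 * ψ (p.1 + p.2))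
      ((surfaceMeasure S₁).prod (surfaceMeasure S₂)) := by
  obtain ⟨C, hC⟩ := hψc.exists_bound_of_continuous hψ
  exact ((hf.integrable h₁).mul_prod (hg.integrable h₂)).mul_bdd (c := C)
    (hψ.comp (continuous_fst.add continuous_snd)).aestronglyMeasurable
    (Eventually.of_forall fun p => hC _)

theorem surfaceConv_eq_integral_prod (h₁ : MeasurableSet S₁) (h₂ : MeasurableSet S₂)
    {f g : E3 → ℂ} (hf : IsCcOn S₁ f) (hg : IsCcOn S₂ g) {ψ : E3 → ℂ} (hψ : Continuous ψ)
    (hψc : HasCompactSupport ψ) :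
    surfaceConv S₁ S₂ f g ψ = ∫ p : E3 × E3, f p.1 * g p.2 * ψ (p.1 + p.2)
      ∂((surfaceMeasure S₁).prod (surfaceMeasure S₂)) :=
  (integral_prod _ (hf.integrable_prod h₁ h₂ hg hψ hψc)).symm

theorem IsContinuousConv.add_left (h₁ : MeasurableSet S₁) (h₂ : MeasurableSet S₂)
    {f f' g h h' : E3 → ℂ} (hf : IsCcOn S₁ f) (hf' : IsCcOn S₁ f') (hg : IsCcOn S₂ g)
    (hh : IsContinuousConv S₁ S₂ f g h) (hh' : IsContinuousConv S₁ S₂ f' g h') :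
    IsContinuousConv S₁ S₂ (f + f') g (h + h') := by
  refine ⟨hh.1.add hh'.1, hh.2.1.add hh'.2.1, fun ψ hψ hψc => ?_⟩
  have hψ' := hψ.continuous
  rw [surfaceConv_eq_integral_prod h₁ h₂ (hf.add hf') hg hψ' hψc]
  have e1 := hh.2.2 ψ hψ hψc
  have e2 := hh'.2.2 ψ hψ hψc
  rw [surfaceConv_eq_integral_prod h₁ h₂ hf hg hψ' hψc] at e1
  rw [surfaceConv_eq_integral_prod h₁ h₂ hf' hg hψ' hψc] at e2
  simp only [Pi.add_apply, add_mul]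
  rw [integral_add, integral_add, e1, e2]
  · exact hf.integrable_prod h₁ h₂ hg hψ' hψc
  · exact hf'.integrable_prod h₁ h₂ hg hψ' hψc
  · exact (hh.1.mul hψ').integrable_of_hasCompactSupport hψc.mul_left
  · exact (hh'.1.mul hψ').integrable_of_hasCompactSupport hψc.mul_left

theorem IsContinuousConv.add_right (h₁ : MeasurableSet S₁) (h₂ : MeasurableSet S₂)
    {f g g' h h' : E3 → ℂ} (hf : IsCcOn S₁ f) (hg : IsCcOn S₂ g) (hg' : IsCcOn S₂ g')
    (hh : IsContinuousConv S₁ S₂ f g h) (hh' : IsContinuousConv S₁ S₂ f g' h') :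
    IsContinuousConv S₁ S₂ f (g + g') (h + h') := by
  refine ⟨hh.1.add hh'.1, hh.2.1.add hh'.2.1, fun ψ hψ hψc => ?_⟩
  have hψ' := hψ.continuous
  rw [surfaceConv_eq_integral_prod h₁ h₂ hf (hg.add hg') hψ' hψc]
  have e1 := hh.2.2 ψ hψ hψc
  have e2 := hh'.2.2 ψ hψ hψc
  rw [surfaceConv_eq_integral_prod h₁ h₂ hf hg hψ' hψc] at e1
  rw [surfaceConv_eq_integral_prod h₁ h₂ hf hg' hψ' hψc] at e2
  simp only [Pi.add_apply, add_mul, mul_add]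
  rw [integral_add, integral_add, e1, e2]
  · exact hf.integrable_prod h₁ h₂ hg hψ' hψc
  · exact hf.integrable_prod h₁ h₂ hg' hψ' hψc
  · exact (hh.1.mul hψ').integrable_of_hasCompactSupport hψc.mul_left
  · exact (hh'.1.mul hψ').integrable_of_hasCompactSupport hψc.mul_left

end Finite

theorem IsContinuousConv.neg_left {f g h : E3 → ℂ} (hh : IsContinuousConv S₁ S₂ f g h) :
    IsContinuousConv S₁ S₂ (-f) g (-h) := by
  refine ⟨hh.1.neg, hh.2.1.neg, fun ψ hψ hψc => ?_⟩
  have := hh.2.2 ψ hψ hψc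
  simp only [surfaceConv, Pi.neg_apply, neg_mul, integral_neg] at this ⊢
  rw [this]

theorem IsContinuousConv.neg_right {f g h : E3 → ℂ} (hh : IsContinuousConv S₁ S₂ f g h) :
    IsContinuousConv S₁ S₂ f (-g) (-h) := by
  refine ⟨hh.1.neg, hh.2.1.neg, fun ψ hψ hψc => ?_⟩
  have := hh.2.2 ψ hψ hψc
  simp only [surfaceConv, Pi.neg_apply, neg_mul, mul_neg, integral_neg] at this ⊢
  rw [this]

theorem IsContinuousConv.zero_left (g : E3 → ℂ) : IsContinuousConv S₁ S₂ 0 g 0 :=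
  ⟨continuous_const, HasCompactSupport.zero, fun ψ _ _ => by simp [surfaceConv]⟩

theorem IsContinuousConv.zero_right (f : E3 → ℂ) : IsContinuousConv S₁ S₂ f 0 0 :=
  ⟨continuous_const, HasCompactSupport.zero, fun ψ _ _ => by simp [surfaceConv]⟩

/-- A function in `C_c(S)` is a finite sum of functions in `C_c(S)` with small supports. -/
theorem IsCcOn.exists_sum_eq {S : Set E3} {f : E3 → ℂ} (hf : IsCcOn S f) {p : Set E3 → Prop}
    (h : ∀ x ∈ S, ∃ V, IsOpen V ∧ x ∈ V ∧ p V) :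
    ∃ (n : ℕ) (F : Fin n → E3 → ℂ), f = ∑ i, F i ∧ ∀ i, IsCcOn S (F i) ∧
      ∃ V, IsOpen V ∧ p V ∧ ∃ K, IsCompact K ∧ K ⊆ S ∩ V ∧ ∀ x ∉ K, F i x = 0 := by
  obtain ⟨hfc, K, hK, hKS, hfK⟩ := hf
  obtain ⟨n, χ, hχ, hsum⟩ := hK.exists_partition_subordinate fun x hx => h x (hKS hx)
  refine ⟨n, fun i x => (χ i x : ℂ) * f x, ?_, fun i => ?_⟩
  · ext x
    rw [Finset.sum_apply, ← Finset.sum_mul]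
    by_cases hx : x ∈ K
    · have : ∑ i, (χ i x : ℂ) = 1 := by exact_mod_cast hsum x hx
      rw [this, one_mul]
    · rw [hfK x hx, mul_zero]
  · obtain ⟨V, hVo, hpV, hχV⟩ := hχ i
    have hcomp : IsCompact (K ∩ tsupport (χ i)) := hK.inter_right (isClosed_tsupport _)
    have hzero : ∀ x ∉ K ∩ tsupport (χ i), (χ i x : ℂ) * f x = 0 := by
      intro x hx
      by_cases hxK : x ∈ K
      · rw [image_eq_zero_of_notMem_tsupport fun h => hx ⟨hxK, h⟩]
        simp
      · rw [hfK x hxK, mul_zero]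
    refine ⟨⟨(Complex.continuous_ofReal.comp (χ i).continuous).continuousOn.mul hfc, _, hcomp,
      Set.inter_subset_left.trans hKS, hzero⟩, V, hVo, hpV, _, hcomp,
      fun x hx => ⟨hKS hx.1, hχV hx.2⟩, hzero⟩

/-- The convolution of two continuous densities supported in charts of transversal surfaces is
continuous. -/
theorem exists_continuous_conv_of_charts {Ω₁ Ω₂ : Set E2} {G₁ G₂ : E2 → E3} (hΩ₁ : IsOpen Ω₁)
    (hΩ₂ : IsOpen Ω₂) (hG₁ : ContDiffOn ℝ 1 G₁ Ω₁) (hG₂ : ContDiffOn ℝ 1 G₂ Ω₂)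
    (htr : ∀ u ∈ Ω₁, ∀ v ∈ Ω₂, ∀ w : E3, (∀ a, inner ℝ w (fderiv ℝ G₁ u a) = 0) →
      (∀ a, inner ℝ w (fderiv ℝ G₂ v a) = 0) → w = 0)
    {F₁ F₂ : E2 → ℂ} (hF₁ : Continuous F₁) (hF₁c : HasCompactSupport F₁) (hF₁Ω : tsupport F₁ ⊆ Ω₁)
    (hF₂ : Continuous F₂) (hF₂c : HasCompactSupport F₂) (hF₂Ω : tsupport F₂ ⊆ Ω₂) :
    ∃ h : E3 → ℂ, Continuous h ∧ HasCompactSupport h ∧ ∀ ψ : E3 → ℂ, Continuous ψ →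
      ∫ u, F₁ u * ∫ v, F₂ v * ψ (G₁ u + G₂ v) = ∫ y, h y * ψ y := by
  set P : E2 × E2 → E3 := fun p => G₁ p.1 + G₂ p.2
  set F : E2 × E2 → ℂ := fun p => F₁ p.1 * F₂ p.2
  have hP : ContDiffOn ℝ 1 P (Ω₁ ×ˢ Ω₂) :=
    (hG₁.comp contDiffOn_fst fun p hp => hp.1).add (hG₂.comp contDiffOn_snd fun p hp => hp.2)
  have hF : Continuous F := (hF₁.comp continuous_fst).mul (hF₂.comp continuous_snd)
  have hK : IsCompact (tsupport F₁ ×ˢ tsupport F₂) := hF₁c.isCompact.prod hF₂c.isCompact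
  have hF0 : ∀ p ∉ tsupport F₁ ×ˢ tsupport F₂, F p = 0 := by
    intro p hp
    simp only [Set.mem_prod, not_and_or] at hp
    rcases hp with hp | hp <;> simp [F, image_eq_zero_of_notMem_tsupport hp]
  obtain ⟨-, hFc, hFt⟩ := hF.continuousOn.continuous_of_eq_zero_off_compact
    (hΩ₁.prod hΩ₂) hK (Set.prod_mono hF₁Ω hF₂Ω) hF0
  have hFΩ := hFt.trans (Set.prod_mono hF₁Ω hF₂Ω)
  obtain ⟨h, hh, hhc, hhi⟩ := exists_density_of_submersion ((volume : Measure E2).prod volume)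
    (volume : Measure E3) (hΩ₁.prod hΩ₂) hP (fun p hp => by
      have hd₁ : HasFDerivAt (fun p : E2 × E2 => G₁ p.1) _ p :=
        HasFDerivAt.comp (g := G₁) p ((hG₁.contDiffAt (hΩ₁.mem_nhds hp.1)).differentiableAt
          (by simp)).hasFDerivAt hasFDerivAt_fst
      have hd₂ : HasFDerivAt (fun p : E2 × E2 => G₂ p.2) _ p :=
        HasFDerivAt.comp (g := G₂) p ((hG₂.contDiffAt (hΩ₂.mem_nhds hp.2)).differentiableAt
          (by simp)).hasFDerivAt hasFDerivAt_snd
      have hd : fderiv ℝ P p = _ := (hd₁.add hd₂).fderiv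
      set D := fderiv ℝ P p
      have hDab : ∀ a b, D (a, b) = fderiv ℝ G₁ p.1 a + fderiv ℝ G₂ p.2 b := fun a b => by
        rw [hd]; simp
      suffices hr : (D : E2 × E2 →ₗ[ℝ] E3).range = ⊤ from LinearMap.range_eq_top.1 hr
      -- A vector orthogonal to the range is normal to both surfaces, so transversality kills it.
      rw [← Submodule.orthogonal_eq_bot_iff, Submodule.eq_bot_iff]
      intro w hw
      rw [Submodule.mem_orthogonal'] at hw
      refine htr p.1 hp.1 p.2 hp.2 w (fun a => ?_) fun b => ?_
      · have := hw (D (a, 0)) ⟨_, rfl⟩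
        rwa [hDab, map_zero, add_zero] at this
      · have := hw (D (0, b)) ⟨_, rfl⟩
        rwa [hDab, map_zero, zero_add] at this)
    hF hFc hFΩ
  refine ⟨h, hh, hhc, fun ψ hψ => ?_⟩
  rw [← hhi ψ hψ]
  have hcO : ContinuousOn (fun p => F p * ψ (P p)) (Ω₁ ×ˢ Ω₂) :=
    hF.continuousOn.mul (hψ.comp_continuousOn hP.continuousOn)
  obtain ⟨h2, h3, -⟩ := hcO.continuous_of_eq_zero_off_compact (hΩ₁.prod hΩ₂) hK
    (Set.prod_mono hF₁Ω hF₂Ω) fun p hp => by rw [hF0 p hp, zero_mul]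
  rw [integral_prod _ (h2.integrable_of_hasCompactSupport h3)]
  congr 1 with u
  rw [← integral_const_mul]
  congr 1 with v
  simp only [F, P, mul_assoc]

variable {U₁ U₂ V₁ V₂ : Set E3} {Φ₁ Φ₂ : E3 → ℝ}

/-- Convolutions of continuous densities on transversal level surfaces are continuous. -/
theorem exists_isContinuousConv [IsFiniteMeasure (surfaceMeasure S₁)]
    [IsFiniteMeasure (surfaceMeasure S₂)] (hU₁ : IsOpen U₁) (hU₂ : IsOpen U₂)
    (hΦ₁ : ContDiffOn ℝ 1 Φ₁ U₁) (hΦ₂ : ContDiffOn ℝ 1 Φ₂ U₂) (hV₁ : IsOpen V₁) (hV₂ : IsOpen V₂)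
    (hS₁ : S₁ = levelSurface U₁ Φ₁ ∩ V₁) (hS₂ : S₂ = levelSurface U₂ Φ₂ ∩ V₂)
    (htr : ∀ x ∈ levelSurface U₁ Φ₁, ∀ y ∈ levelSurface U₂ Φ₂, ∀ (c d : ℝ),
      c • gradient Φ₁ x = d • gradient Φ₂ y → c • gradient Φ₁ x = 0)
    {f g : E3 → ℂ} (hf : IsCcOn S₁ f) (hg : IsCcOn S₂ g) :
    ∃ h : E3 → ℂ, IsContinuousConv S₁ S₂ f g h := by
  have hm₁ : MeasurableSet S₁ := by
    rw [hS₁]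
    exact (isLocallyClosed_levelSurface hU₁ hΦ₁).measurableSet.inter hV₁.measurableSet
  have hm₂ : MeasurableSet S₂ := by
    rw [hS₂]
    exact (isLocallyClosed_levelSurface hU₂ hΦ₂).measurableSet.inter hV₂.measurableSet
  obtain ⟨n₁, f', rfl, hf'⟩ := hf.exists_sum_eq
    (p := fun O => ∃ (Ω : Set E2) (G : E2 → E3), IsOpen Ω ∧
      ContDiffOn ℝ 1 G Ω ∧ Set.InjOn G Ω ∧ (∀ u ∈ Ω, Function.Injective (fderiv ℝ G u)) ∧
      G '' Ω = S₁ ∩ O ∧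
      (∀ u ∈ Ω, ∀ a, inner ℝ (gradient Φ₁ (G u)) (fderiv ℝ G u a) = 0) ∧
      ∀ K ⊆ S₁ ∩ O, IsCompact K → IsCompact (Ω ∩ G ⁻¹' K)) fun x hx => by
    rw [hS₁] at hx ⊢
    obtain ⟨O, Ω, G, hO, hxO, h⟩ := exists_chart_levelSurface hU₁ hΦ₁ hV₁ hx
    exact ⟨O, hO, hxO, Ω, G, h⟩
  obtain ⟨n₂, g', rfl, hg'⟩ := hg.exists_sum_eq
    (p := fun O => ∃ (Ω : Set E2) (G : E2 → E3), IsOpen Ω ∧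
      ContDiffOn ℝ 1 G Ω ∧ Set.InjOn G Ω ∧ (∀ u ∈ Ω, Function.Injective (fderiv ℝ G u)) ∧
      G '' Ω = S₂ ∩ O ∧
      (∀ u ∈ Ω, ∀ a, inner ℝ (gradient Φ₂ (G u)) (fderiv ℝ G u a) = 0) ∧
      ∀ K ⊆ S₂ ∩ O, IsCompact K → IsCompact (Ω ∩ G ⁻¹' K)) fun x hx => by
    rw [hS₂] at hx ⊢
    obtain ⟨O, Ω, G, hO, hxO, h⟩ := exists_chart_levelSurface hU₂ hΦ₂ hV₂ hx
    exact ⟨O, hO, hxO, Ω, G, h⟩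
  have hpair : ∀ i j, ∃ h : E3 → ℂ, IsContinuousConv S₁ S₂ (f' i) (g' j) h := by
    intro i j
    obtain ⟨hfi, O₁, hO₁, ⟨Ω₁, G₁, hΩ₁, hG₁, hi₁, hd₁, himg₁, hn₁, hp₁⟩, K₁, hK₁, hKO₁, hz₁⟩ :=
      hf' i
    obtain ⟨hgj, O₂, hO₂, ⟨Ω₂, G₂, hΩ₂, hG₂, hi₂, hd₂, himg₂, hn₂, hp₂⟩, K₂, hK₂, hKO₂, hz₂⟩ :=
      hg' j
    obtain ⟨F₁, hF₁, hF₁c, hF₁Ω, hF₁i⟩ := exists_pullback_density hO₁ hΩ₁ hG₁ hi₁ hd₁ himg₁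
      hp₁ hfi.1 hK₁ hKO₁ hz₁
    obtain ⟨F₂, hF₂, hF₂c, hF₂Ω, hF₂i⟩ := exists_pullback_density hO₂ hΩ₂ hG₂ hi₂ hd₂ himg₂
      hp₂ hgj.1 hK₂ hKO₂ hz₂
    have hL₁ : ∀ u ∈ Ω₁, G₁ u ∈ levelSurface U₁ Φ₁ := fun u hu => by
      have h1 : G₁ u ∈ S₁ ∩ O₁ := himg₁.subset ⟨u, hu, rfl⟩
      rw [hS₁] at h1
      exact h1.1.1
    have hL₂ : ∀ u ∈ Ω₂, G₂ u ∈ levelSurface U₂ Φ₂ := fun u hu => by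
      have h1 : G₂ u ∈ S₂ ∩ O₂ := himg₂.subset ⟨u, hu, rfl⟩
      rw [hS₂] at h1
      exact h1.1.1
    obtain ⟨h, hh, hhc, hhi⟩ := exists_continuous_conv_of_charts hΩ₁ hΩ₂ hG₁ hG₂
      (fun u hu v hv w hwu hwv => by
        obtain ⟨c, hc⟩ := exists_eq_smul_of_orthogonal_range (hd₁ u hu) (hL₁ u hu).2.2
          (hn₁ u hu) hwu
        obtain ⟨d, hd⟩ := exists_eq_smul_of_orthogonal_range (hd₂ v hv) (hL₂ v hv).2.2
          (hn₂ v hv) hwv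
        rw [← hc]
        exact htr _ (hL₁ u hu) _ (hL₂ v hv) c d (hc.trans hd.symm))
      hF₁ hF₁c hF₁Ω hF₂ hF₂c hF₂Ω
    refine ⟨h, hh, hhc, fun ψ hψ hψc => ?_⟩
    rw [← hhi ψ hψ.continuous, surfaceConv]
    simp_rw [mul_assoc, integral_const_mul]
    rw [hF₁i fun x => ∫ y, g' j y * ψ (x + y) ∂surfaceMeasure S₂]
    congr 1 with u
    rw [hF₂i fun y => ψ (G₁ u + y)]
  have hright : ∀ i, IsCcOn S₂ (∑ j, g' j) ∧
      ∃ h : E3 → ℂ, IsContinuousConv S₁ S₂ (f' i) (∑ j, g' j) h := by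
    intro i
    refine Finset.sum_induction g'
      -- Membership in `C_c` is carried along the induction because additivity of the convolution
      -- needs the integrability it provides.
      (fun g => IsCcOn S₂ g ∧ ∃ h : E3 → ℂ, IsContinuousConv S₁ S₂ (f' i) g h) ?_ ?_ ?_
    · rintro a b ⟨ha, h, hh⟩ ⟨hb, h', hh'⟩
      exact ⟨ha.add hb, _, hh.add_right hm₁ hm₂ (hf' i).1 ha hb hh'⟩
    · exact ⟨IsCcOn.zero _, 0, IsContinuousConv.zero_right _⟩
    · exact fun j _ => ⟨(hg' j).1, hpair i j⟩
  refine (Finset.sum_induction f'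
    (fun f => IsCcOn S₁ f ∧ ∃ h : E3 → ℂ, IsContinuousConv S₁ S₂ f (∑ j, g' j) h) ?_ ?_ ?_).2
  · rintro a b ⟨ha, h, hh⟩ ⟨hb, h', hh'⟩
    exact ⟨ha.add hb, _, hh.add_left hm₁ hm₂ ha hb hg hh'⟩
  · exact ⟨IsCcOn.zero _, 0, IsContinuousConv.zero_left _⟩
  · exact fun i _ => ⟨(hf' i).1, (hright i).2⟩

end Convolution

/-! ### The trilinear estimate -/

section Transversality

/-- Cramer's rule: each coordinate of `w`, times the determinant, is a sum of three products of an
inner product with a minor of size at most `2`. As the determinant is at least `1 / 2`, each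
coordinate is at most `12 * a`. -/
theorem norm_le_of_det_ge {n : Fin 3 → E3} (hn : ∀ i, ‖n i‖ = 1)
    (hdet : 1 / 2 ≤ (Matrix.of fun k i => n i k).det) {w : E3} {a : ℝ}
    (ha : ∀ i, |inner ℝ (n i) w| ≤ a) : ‖w‖ ≤ 36 * a := by
  have hcoord : ∀ i k, |n i k| ≤ 1 := fun i k => by
    have := PiLp.norm_apply_le (n i) k
    rwa [hn i, Real.norm_eq_abs] at this
  have ha0 : 0 ≤ a := (abs_nonneg _).trans (ha 0)
  have hinner : ∀ i, inner ℝ (n i) w = n i 0 * w 0 + n i 1 * w 1 + n i 2 * w 2 := fun i => by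
    rw [PiLp.inner_apply, Fin.sum_univ_three]
    simp only [RCLike.inner_apply, conj_trivial]
    ring
  have hminor : ∀ i j k l, |n i k * n j l - n i l * n j k| ≤ 2 := fun i j k l => by
    have h1 : |n i k * n j l| ≤ 1 := by
      rw [abs_mul]; exact mul_le_one₀ (hcoord i k) (abs_nonneg _) (hcoord j l)
    have h2 : |n i l * n j k| ≤ 1 := by
      rw [abs_mul]; exact mul_le_one₀ (hcoord i l) (abs_nonneg _) (hcoord j k)
    have := abs_sub (n i k * n j l) (n i l * n j k)
    linarith
  set d := (Matrix.of fun k i => n i k).det with hd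
  rw [Matrix.det_fin_three] at hd
  simp only [Matrix.of_apply] at hd
  have hterm : ∀ i j j' k l, |inner ℝ (n i) w * (n j k * n j' l - n j l * n j' k)| ≤ 2 * a := by
    intro i j j' k l
    rw [abs_mul, mul_comm 2 a]
    exact mul_le_mul (ha i) (hminor j j' k l) (abs_nonneg _) ha0
  have key : ∀ k l m, d * w k = inner ℝ (n 0) w * (n 1 l * n 2 m - n 1 m * n 2 l) +
      inner ℝ (n 1) w * (n 2 l * n 0 m - n 2 m * n 0 l) +
      inner ℝ (n 2) w * (n 0 l * n 1 m - n 0 m * n 1 l) → |w k| ≤ 12 * a := by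
    intro k l m h
    have h1 := hterm 0 1 2 l m
    have h2 := hterm 1 2 0 l m
    have h3 := hterm 2 0 1 l m
    have h4 : |d * w k| ≤ 6 * a := by
      rw [h]
      refine (abs_add_le _ _).trans ?_
      have := abs_add_le (inner ℝ (n 0) w * (n 1 l * n 2 m - n 1 m * n 2 l))
        (inner ℝ (n 1) w * (n 2 l * n 0 m - n 2 m * n 0 l))
      linarith
    rw [abs_mul, abs_of_pos (by linarith : 0 < d)] at h4
    nlinarith [abs_nonneg (w k)]
  have h0 := key 0 1 2 (by rw [hd, hinner, hinner, hinner]; ring)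
  have h1 := key 1 2 0 (by rw [hd, hinner, hinner, hinner]; ring)
  have h2 := key 2 0 1 (by rw [hd, hinner, hinner, hinner]; ring)
  rw [EuclideanSpace.norm_eq, Fin.sum_univ_three]
  refine Real.sqrt_le_iff.2 ⟨by positivity, ?_⟩
  have hs : ∀ k, |w k| ≤ 12 * a → ‖w k‖ ^ 2 ≤ (12 * a) ^ 2 := fun k hk => by
    rw [Real.norm_eq_abs]
    exact pow_le_pow_left₀ (abs_nonneg _) hk 2
  nlinarith [hs 0 h0, hs 1 h1, hs 2 h2, sq_nonneg a]

variable {β : ℝ≥0}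

/-- Two nearby points which are both `ε`-close to two translated surfaces are at distance
`O(ε)`. -/
theorem exists_norm_sub_le_of_transversal (hβ : 0 < β) :
    ∃ δ : ℝ, 0 < δ ∧ ∀ (S U : Fin 3 → Set E3) (Φ : Fin 3 → E3 → ℝ) (n : Fin 3 → E3 → E3),
      (∀ i, IsSurfacePiece β 1 (S i) (U i) (Φ i) (n i)) →
      (∀ σ : Fin 3 → E3, (∀ i, σ i ∈ levelSurface (U i) (Φ i)) →
        1 / 2 ≤ (Matrix.of fun k i => n i (σ i) k).det) →
      ∀ (σ τ p : Fin 3 → E3) (z z' : E3) (ε : ℝ), (∀ i, σ i ∈ S i) → (∀ i, τ i ∈ S i) →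
        (∀ i, ‖z - p i - σ i‖ ≤ ε) → (∀ i, ‖z' - p i - τ i‖ ≤ ε) → ε ≤ δ → ‖z - z'‖ ≤ δ →
          ‖z - z'‖ ≤ 146 * ε := by
  -- Since `36 / 72 = 1 / 2`, half of `‖z - z'‖` is absorbed on the left; what remains is `36 + 36 *
  -- 2 * … = ‖z - z'‖ / 2 ≤ 73 * ε`. The radius `r / 3` ensures `‖σ i - τ i‖ ≤ r`.
  obtain ⟨r, hr, hrβ⟩ := exists_rpow_le hβ (a := 1 / 72) (by norm_num)
  refine ⟨r / 3, by positivity,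
    fun S U Φ n hS hdet σ τ p z z' ε hσ hτ hzσ hzτ hε hzz => ?_⟩
  have hσL := fun i => (hS i).subset_levelSurface (hσ i)
  have hτL := fun i => (hS i).subset_levelSurface (hτ i)
  have h1 := norm_le_of_det_ge (n := fun i => n i (σ i)) (w := z - z')
    (a := 1 / 72 * (‖z - z'‖ + 2 * ε) + 2 * ε) (fun i => (hS i).norm_normal _ (hσL i))
    (hdet σ hσL) fun i => by
      set e := (z - p i - σ i) - (z' - p i - τ i)
      have he : ‖e‖ ≤ 2 * ε := by
        have := norm_sub_le (z - p i - σ i) (z' - p i - τ i)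
        linarith [hzσ i, hzτ i]
      have hz : z - z' = (σ i - τ i) + e := by simp only [e]; abel
      have hst : ‖σ i - τ i‖ ≤ ‖z - z'‖ + 2 * ε := by
        have : σ i - τ i = (z - z') - e := by rw [hz]; abel
        rw [this]
        exact (norm_sub_le _ _).trans (by linarith)
      have h2 := (hS i).abs_inner_normal_sub_le (hσL i) (hτL i)
      have h3 := hrβ _ (norm_nonneg (σ i - τ i)) (by linarith)
      have h4 : |inner ℝ (n i (σ i)) e| ≤ 2 * ε := by
        refine (abs_real_inner_le_norm _ _).trans ?_
        rw [(hS i).norm_normal _ (hσL i), one_mul]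
        exact he
      have h5 : ‖σ i - τ i‖ ^ (β : ℝ) * ‖σ i - τ i‖ ≤ 1 / 72 * (‖z - z'‖ + 2 * ε) := by
        gcongr
      have h6 := abs_add_le (inner ℝ (n i (σ i)) (σ i - τ i)) (inner ℝ (n i (σ i)) e)
      rw [← inner_add_right, ← hz] at h6
      linarith
  linarith

end Transversality

/-! ### The kernel bound and the weighted Cauchy–Schwarz inequality -/

section Kernel

variable {β : ℝ≥0}

theorem lintegral_le_mul_measure_of_le {X : Type*} [MeasurableSpace X] {μ : Measure X}
    {k : X → ℝ≥0∞} {L : ℝ≥0∞} {B : Set X} (hk : ∀ᵐ x ∂μ, k x ≤ B.indicator (fun _ => L) x) :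
    ∫⁻ x, k x ∂μ ≤ L * μ B :=
  (lintegral_mono_ae hk).trans (lintegral_indicator_const_le _ _)

/-- Triple intersections of `ε`-neighbourhoods of translated transversal surfaces are small. -/
theorem exists_lintegral_kernel_le (hβ : 0 < β) :
    ∃ ε₀ : ℝ, 0 < ε₀ ∧ ∃ C : ℝ≥0, ∀ S : Fin 3 → Set E3, TransversalTriple β 1 (1 / 2) S →
      (∀ i, Metric.diam (S i) ≤ 1) → ∀ (ε : ℝ), 0 < ε → ε ≤ ε₀ → ∀ (k : E3 → ℝ≥0∞) (L : ℝ≥0∞),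
        (∀ v, k v ≤ L) → (∀ v, ε < ‖v‖ → k v = 0) → ∀ p q : E3,
          ∫⁻ z, (∫⁻ y, k (z - p - y) ∂surfaceMeasure (S 1)) *
            (∫⁻ x, k (z - x - q) ∂surfaceMeasure (S 0)) ∂surfaceMeasure (S 2) ≤
          C * (L ^ 2 * ENNReal.ofReal ε ^ 6) := by
  obtain ⟨r₀, hr₀, M, hM⟩ := exists_surfaceMeasure_closedBall_le hβ
  obtain ⟨δ, hδ, hcl⟩ := exists_norm_sub_le_of_transversal hβ
  -- The cover of the unit ball is chosen before the surfaces, so its cardinality is uniform. Two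
  -- points in one of its balls of radius `δ / 2` are close enough for the transversality estimate.
  obtain ⟨t, -, htf, htc⟩ := (isCompact_closedBall (0 : E3) 1).finite_cover_balls
    (half_pos hδ)
  lift t to Finset E3 using htf
  -- One `M` for each inner integral; the last factor bounds the triple intersection by `t.card`
  -- balls of radius `146 * ε`.
  refine ⟨min δ (r₀ / 146), by positivity, M * M * (t.card * (M * 146 ^ 2)),
    fun S hS hdiam ε hε hε₀ k L hkL hk0 p q => ?_⟩
  obtain ⟨U, Φ, n, hpiece, hdet⟩ := hS
  have hεδ : ε ≤ δ := hε₀.trans (min_le_left _ _)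
  have hεr : 146 * ε ≤ r₀ := by
    have := hε₀.trans (min_le_right _ _)
    rw [le_div_iff₀ (by norm_num)] at this
    linarith
  have hεr' : ε ≤ r₀ := by linarith
  have hM' : ∀ i (c : E3) (r : ℝ), 0 ≤ r → r ≤ r₀ →
      surfaceMeasure (S i) (Metric.closedBall c r) ≤ M * ENNReal.ofReal r ^ 2 :=
    fun i => hM _ _ _ _ (hpiece i)
  have hmeas : ∀ i, MeasurableSet (S i) := fun i => (hpiece i).isLocallyClosed.measurableSet
  -- On `S 2`, off this set, one of the two inner integrals vanishes.
  set Z : Set E3 := {z | z ∈ S 2 ∧ (∃ y ∈ S 1, ‖z - p - y‖ ≤ ε) ∧ ∃ x ∈ S 0, ‖z - q - x‖ ≤ ε}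
  have hZ : surfaceMeasure (S 2) Z ≤ t.card * (M * ENNReal.ofReal (146 * ε) ^ 2) := by
    obtain ⟨s, hs⟩ := (hpiece 2).nonempty
    have hcov : Z ⊆ ⋃ c ∈ t, Z ∩ Metric.ball (s + c) (δ / 2) := by
      intro z hz
      have hzs : z - s ∈ Metric.closedBall (0 : E3) 1 := by
        rw [mem_closedBall_zero_iff, ← dist_eq_norm]
        exact (Metric.dist_le_diam_of_mem (hpiece 2).bounded hz.1 hs).trans (hdiam 2)
      have := htc hzs
      simp only [Set.mem_iUnion] at this ⊢
      obtain ⟨c, hc, hzc⟩ := this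
      refine ⟨c, hc, hz, ?_⟩
      rw [mem_ball_iff_norm] at hzc ⊢
      rwa [← sub_sub]
    refine (measure_mono hcov).trans ((measure_biUnion_finset_le _ _).trans ?_)
    rw [← nsmul_eq_mul]
    refine Finset.sum_le_card_nsmul _ _ _ fun c _ => ?_
    rcases (Z ∩ Metric.ball (s + c) (δ / 2)).eq_empty_or_nonempty with he | ⟨z₀, hz₀, hz₀b⟩
    · simp [he]
    refine (measure_mono ?_).trans (hM' 2 z₀ (146 * ε) (by positivity) hεr)
    rintro z ⟨hz, hzb⟩
    rw [mem_closedBall_iff_norm]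
    obtain ⟨hzS, ⟨y, hy, hzy⟩, x, hx, hzx⟩ := hz
    obtain ⟨hzS₀, ⟨y₀, hy₀, hzy₀⟩, x₀, hx₀, hzx₀⟩ := hz₀
    -- The third surface is not translated, and `z`, `z₀` serve as their own approximants on it with
    -- error zero.
    refine hcl S U Φ n hpiece (fun σ hσ => (hdet σ hσ).1) ![x, y, z] ![x₀, y₀, z₀] ![q, p, 0]
      z z₀ ε ?_ ?_ ?_ ?_ hεδ ?_
    · intro i; fin_cases i <;> simpa
    · intro i; fin_cases i <;> simpa
    · intro i; fin_cases i
      · simpa using hzx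
      · simpa using hzy
      · simpa using hε.le
    · intro i; fin_cases i
      · simpa using hzx₀
      · simpa using hzy₀
      · simpa using hε.le
    · rw [← dist_eq_norm]
      have := dist_triangle_right z z₀ (s + c)
      rw [Metric.mem_ball] at hzb hz₀b
      linarith
  have hbase : ∀ (i : Fin 3) (c : E3) (k' : E3 → ℝ≥0∞), (∀ y, k' y ≤ L) →
      (∀ y, ε < ‖c - y‖ → k' y = 0) →
      ∫⁻ y, k' y ∂surfaceMeasure (S i) ≤ L * (M * ENNReal.ofReal ε ^ 2) := by
    intro i c k' hk'L hk'0
    refine (lintegral_le_mul_measure_of_le (L := L) (B := Metric.closedBall c ε)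
      (Eventually.of_forall fun y => ?_)).trans ?_
    · by_cases hy : y ∈ Metric.closedBall c ε
      · rw [Set.indicator_of_mem hy]; exact hk'L y
      · rw [Set.indicator_of_notMem hy, hk'0 y]
        rwa [mem_closedBall_iff_norm', not_le] at hy
    · gcongr
      exact hM' i c ε hε.le hεr'
  have hzero : ∀ (i : Fin 3) (k' : E3 → ℝ≥0∞), (∀ y ∈ S i, k' y = 0) →
      ∫⁻ y, k' y ∂surfaceMeasure (S i) = 0 := by
    intro i k' hk'
    rw [surfaceMeasure, setLIntegral_congr_fun (hmeas i) hk']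
    simp
  have hmain : ∀ᵐ z ∂surfaceMeasure (S 2), (∫⁻ y, k (z - p - y) ∂surfaceMeasure (S 1)) *
      (∫⁻ x, k (z - x - q) ∂surfaceMeasure (S 0)) ≤ Z.indicator
        (fun _ => L * (M * ENNReal.ofReal ε ^ 2) * (L * (M * ENNReal.ofReal ε ^ 2))) z := by
    filter_upwards [ae_restrict_mem (hmeas 2)] with z hzS
    by_cases hz : z ∈ Z
    · rw [Set.indicator_of_mem hz]
      refine mul_le_mul' (hbase 1 (z - p) _ (fun y => hkL _) fun y hy => hk0 _ hy)
        (hbase 0 (z - q) _ (fun x => hkL _) fun x hx => hk0 _ ?_)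
      rwa [sub_right_comm]
    · rw [Set.indicator_of_notMem hz]
      have : (∀ y ∈ S 1, ε < ‖z - p - y‖) ∨ ∀ x ∈ S 0, ε < ‖z - q - x‖ := by
        by_contra! hcon
        exact hz ⟨hzS, hcon⟩
      rcases this with h | h
      · rw [hzero 1 _ fun y hy => hk0 _ (h y hy), zero_mul]
      · rw [hzero 0 _ fun x hx => hk0 _ (by rw [sub_right_comm]; exact h x hx), mul_zero]
  calc _ ≤ _ := lintegral_le_mul_measure_of_le hmain
    _ ≤ L * (M * ENNReal.ofReal ε ^ 2) * (L * (M * ENNReal.ofReal ε ^ 2)) *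
        (t.card * (M * ENNReal.ofReal (146 * ε) ^ 2)) := by gcongr
    _ = _ := by
      rw [ENNReal.ofReal_mul (by norm_num)]
      push_cast
      simp only [ENNReal.ofReal_ofNat]
      ring

variable {μ₀ μ₁ μ₂ : Measure E3} [IsFiniteMeasure μ₀] [IsFiniteMeasure μ₁] [IsFiniteMeasure μ₂]

theorem lintegral_prod_mul_sq_le {X : Type*} [MeasurableSpace X] {μ : Measure X}
    {a b k : X → ℝ≥0∞} (ha : Measurable a) (hb : Measurable b) (hk : Measurable k) :
    (∫⁻ x, a x * b x * k x ∂μ) ^ 2 ≤ (∫⁻ x, a x ^ 2 * k x ∂μ) * ∫⁻ x, b x ^ 2 * k x ∂μ := by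
  have hsq : ∀ t : ℝ≥0∞, (t ^ (1 / 2 : ℝ)) ^ 2 = t := fun t => by
    rw [← ENNReal.rpow_natCast, ← ENNReal.rpow_mul]
    norm_num
  have h := ENNReal.lintegral_mul_le_Lp_mul_Lq μ Real.HolderConjugate.two_two
    (f := fun x => a x * k x ^ (1 / 2 : ℝ)) (g := fun x => b x * k x ^ (1 / 2 : ℝ))
    (ha.mul (hk.pow_const _)).aemeasurable (hb.mul (hk.pow_const _)).aemeasurable
  have e1 : ∀ x, a x * k x ^ (1 / 2 : ℝ) * (b x * k x ^ (1 / 2 : ℝ)) = a x * b x * k x := by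
    intro x
    rw [mul_mul_mul_comm, ← sq, hsq]
  simp only [Pi.mul_apply, e1, ENNReal.rpow_two, mul_pow, hsq] at h
  calc _ ≤ _ := pow_le_pow_left' h 2
    _ = _ := by rw [mul_pow, hsq, hsq]

/-- After Cauchy–Schwarz with weight `k`, the two factors `a z x` and `b z y` no longer involve `φ`
and `γ`. Tonelli then isolates the `z`-integral of `a z x * b z y`, which `hD` bounds for each pair
`(x, y)`. -/
theorem lintegral_conv_sq_le {k : E3 → ℝ≥0∞} (hk : Measurable k) {D : ℝ≥0∞}
    (hD : ∀ p q, ∫⁻ z, (∫⁻ y, k (z - p - y) ∂μ₁) * (∫⁻ x, k (z - x - q) ∂μ₀) ∂μ₂ ≤ D)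
    {φ γ : E3 → ℝ≥0∞} (hφ : Measurable φ) (hγ : Measurable γ) :
    ∫⁻ z, (∫⁻ p : E3 × E3, φ p.1 * γ p.2 * k (z - p.1 - p.2) ∂(μ₀.prod μ₁)) ^ 2 ∂μ₂ ≤
      D * ((∫⁻ x, φ x ^ 2 ∂μ₀) * ∫⁻ y, γ y ^ 2 ∂μ₁) := by
  set a : E3 → E3 → ℝ≥0∞ := fun z x => ∫⁻ y, k (z - x - y) ∂μ₁
  set b : E3 → E3 → ℝ≥0∞ := fun z y => ∫⁻ x, k (z - x - y) ∂μ₀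
  have ha : Measurable fun p : E3 × E3 => a p.1 p.2 := by
    refine Measurable.lintegral_prod_right' (f := fun q : (E3 × E3) × E3 =>
      k (q.1.1 - q.1.2 - q.2)) (hk.comp (by fun_prop))
  have hb : Measurable fun p : E3 × E3 => b p.1 p.2 := by
    refine Measurable.lintegral_prod_right' (f := fun q : (E3 × E3) × E3 =>
      k (q.1.1 - q.2 - q.1.2)) (hk.comp (by fun_prop))
  have hk3 : ∀ z, Measurable fun p : E3 × E3 => k (z - p.1 - p.2) := fun z =>
    hk.comp (by fun_prop)
  have hpt : ∀ z, (∫⁻ p : E3 × E3, φ p.1 * γ p.2 * k (z - p.1 - p.2) ∂(μ₀.prod μ₁)) ^ 2 ≤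
      ∫⁻ x, ∫⁻ y, φ x ^ 2 * γ y ^ 2 * (a z x * b z y) ∂μ₁ ∂μ₀ := by
    intro z
    refine (lintegral_prod_mul_sq_le (a := fun p : E3 × E3 => φ p.1)
      (b := fun p : E3 × E3 => γ p.2) (hφ.comp measurable_fst) (hγ.comp measurable_snd)
      (hk3 z)).trans (le_of_eq ?_)
    have h1 : ∫⁻ p : E3 × E3, φ p.1 ^ 2 * k (z - p.1 - p.2) ∂(μ₀.prod μ₁) =
        ∫⁻ x, φ x ^ 2 * a z x ∂μ₀ := by
      have hm : Measurable fun p : E3 × E3 => φ p.1 ^ 2 * k (z - p.1 - p.2) :=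
        ((hφ.comp measurable_fst).pow_const 2).mul (hk3 z)
      rw [lintegral_prod _ hm.aemeasurable]
      refine lintegral_congr fun x => ?_
      have hm : Measurable fun y => k (z - x - y) := (hk3 z).comp measurable_prodMk_left
      exact lintegral_const_mul (φ x ^ 2) hm
    have h2 : ∫⁻ p : E3 × E3, γ p.2 ^ 2 * k (z - p.1 - p.2) ∂(μ₀.prod μ₁) =
        ∫⁻ y, γ y ^ 2 * b z y ∂μ₁ := by
      have hm : Measurable fun p : E3 × E3 => γ p.2 ^ 2 * k (z - p.1 - p.2) :=
        ((hγ.comp measurable_snd).pow_const 2).mul (hk3 z)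
      rw [lintegral_prod_symm _ hm.aemeasurable]
      refine lintegral_congr fun y => ?_
      have hm : Measurable fun x => k (z - x - y) := (hk3 z).comp measurable_prodMk_right
      exact lintegral_const_mul (γ y ^ 2) hm
    have hbz : Measurable (b z) := hb.comp measurable_prodMk_left
    have haz : Measurable (a z) := ha.comp measurable_prodMk_left
    have hma : Measurable fun x => φ x ^ 2 * a z x := (hφ.pow_const 2).mul haz
    have hmb : Measurable fun y => γ y ^ 2 * b z y := (hγ.pow_const 2).mul hbz
    rw [h1, h2, ← lintegral_mul_const _ hma]
    refine lintegral_congr fun x => ?_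
    rw [← lintegral_const_mul _ hmb]
    refine lintegral_congr fun y => ?_
    ring
  have hjoint : Measurable fun q : (E3 × E3) × E3 =>
      φ q.1.2 ^ 2 * γ q.2 ^ 2 * (a q.1.1 q.1.2 * b q.1.1 q.2) := by
    refine Measurable.mul (Measurable.mul ?_ ?_) (Measurable.mul ?_ ?_)
    · exact (hφ.comp (measurable_snd.comp measurable_fst)).pow_const 2
    · exact (hγ.comp measurable_snd).pow_const 2
    · exact ha.comp measurable_fst
    · exact hb.comp ((measurable_fst.comp measurable_fst).prodMk measurable_snd)
  calc _ ≤ ∫⁻ z, ∫⁻ x, ∫⁻ y, φ x ^ 2 * γ y ^ 2 * (a z x * b z y) ∂μ₁ ∂μ₀ ∂μ₂ :=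
        lintegral_mono hpt
    _ = ∫⁻ x, ∫⁻ z, ∫⁻ y, φ x ^ 2 * γ y ^ 2 * (a z x * b z y) ∂μ₁ ∂μ₂ ∂μ₀ :=
        lintegral_lintegral_swap (Measurable.lintegral_prod_right' hjoint).aemeasurable
    _ = ∫⁻ x, ∫⁻ y, ∫⁻ z, φ x ^ 2 * γ y ^ 2 * (a z x * b z y) ∂μ₂ ∂μ₁ ∂μ₀ := by
        refine lintegral_congr fun x => lintegral_lintegral_swap ?_
        exact (hjoint.comp ((measurable_fst.prodMk measurable_const).prodMk
          measurable_snd)).aemeasurable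
    _ = ∫⁻ x, ∫⁻ y, φ x ^ 2 * γ y ^ 2 * ∫⁻ z, a z x * b z y ∂μ₂ ∂μ₁ ∂μ₀ := by
        refine lintegral_congr fun x => lintegral_congr fun y => lintegral_const_mul _ ?_
        exact (ha.comp measurable_prodMk_right).mul (hb.comp measurable_prodMk_right)
    _ ≤ ∫⁻ x, ∫⁻ y, φ x ^ 2 * γ y ^ 2 * D ∂μ₁ ∂μ₀ := by
        gcongr with x y
        exact hD x y
    _ = _ := by
        have : ∀ x, ∫⁻ y, φ x ^ 2 * γ y ^ 2 * D ∂μ₁ = φ x ^ 2 * ((∫⁻ y, γ y ^ 2 ∂μ₁) * D) := by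
          intro x
          rw [← lintegral_mul_const _ (hγ.pow_const 2),
            ← lintegral_const_mul _ ((hγ.pow_const 2).mul_const D)]
          simp only [mul_assoc]
        simp_rw [this]
        rw [lintegral_mul_const _ (hφ.pow_const 2)]
        ring

end Kernel

/-! ### The `L²` bound for convolutions and its extension by density -/

section Estimate

variable {β : ℝ≥0}

theorem IsCcOn.measurable {S : Set E3} {f : E3 → ℂ} (hf : IsCcOn S f) : Measurable f := by
  classical
  obtain ⟨hfc, K, hK, hKS, hfK⟩ := hf
  have h := (hfc.mono hKS).measurable_piecewise (g := fun _ => 0) continuousOn_const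
    hK.measurableSet
  convert h using 1
  ext x
  by_cases hx : x ∈ K
  · rw [Set.piecewise_eq_of_mem _ _ _ hx]
  · rw [Set.piecewise_eq_of_notMem _ _ _ hx, hfK x hx]

theorem eLpNorm_two_sq_eq_lintegral {X : Type*} [MeasurableSpace X] (μ : Measure X) (f : X → ℂ) :
    eLpNorm f 2 μ ^ 2 = ∫⁻ x, ‖f x‖ₑ ^ 2 ∂μ := by
  have := eLpNorm_nnreal_pow_eq_lintegral (f := f) (μ := μ) (p := 2) two_ne_zero
  simpa using this

/-- The inner radius is `ε / 2`, so the normalized bump has height at most `2 ^ 3` over the volume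
of the ball of radius `ε`. -/
theorem exists_bump_kernel {ε : ℝ} (hε : 0 < ε) :
    ∃ b : ContDiffBump (0 : E3), b.rOut = ε ∧
      (∀ v, ENNReal.ofReal (b.normed volume v) ≤
        ENNReal.ofReal (8 / (ε ^ 3 * volume.real (Metric.ball (0 : E3) 1)))) ∧
      ∀ v, ε < ‖v‖ → ENNReal.ofReal (b.normed volume v) = 0 := by
  refine ⟨⟨ε / 2, ε, half_pos hε, half_lt_self hε⟩, rfl, fun v => ?_, fun v hv => ?_⟩
  · refine ENNReal.ofReal_le_ofReal ?_
    refine (ContDiffBump.normed_le_div_measure_closedBall_rOut _ volume 2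
      (by change ε ≤ 2 * (ε / 2); linarith) v).trans ?_
    rw [Measure.addHaar_real_closedBall _ _ hε.le, finrank_euclideanSpace_fin]
    norm_num
  · rw [ENNReal.ofReal_eq_zero]
    refine le_of_eq (Function.notMem_support.1 fun h => ?_)
    rw [ContDiffBump.support_normed_eq, mem_ball_zero_iff] at h
    exact absurd h (not_lt.2 hv.le)

/-- Testing the distribution against the reflected bump centred at `z` expresses the mollification
of `h` through `f` and `g`. -/
theorem IsContinuousConv.enorm_convolution_le {S₁ S₂ : Set E3} (h₁ : MeasurableSet S₁)
    (h₂ : MeasurableSet S₂) [IsFiniteMeasure (surfaceMeasure S₁)]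
    [IsFiniteMeasure (surfaceMeasure S₂)] {f g h : E3 → ℂ} (hf : IsCcOn S₁ f) (hg : IsCcOn S₂ g)
    (hh : IsContinuousConv S₁ S₂ f g h) (b : ContDiffBump (0 : E3)) (z : E3) :
    ‖convolution (b.normed volume) h (ContinuousLinearMap.lsmul ℝ ℝ) volume z‖ₑ ≤
      ∫⁻ p : E3 × E3, ‖f p.1‖ₑ * ‖g p.2‖ₑ * ENNReal.ofReal (b.normed volume (z - p.1 - p.2))
        ∂((surfaceMeasure S₁).prod (surfaceMeasure S₂)) := by
  set ψ : E3 → ℂ := fun v => (b.normed volume (z - v) : ℂ)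
  have hψ : ContDiff ℝ ∞ ψ :=
    Complex.ofRealCLM.contDiff.comp (b.contDiff_normed.comp (contDiff_const.sub contDiff_id))
  have hψc : HasCompactSupport ψ := by
    have h1 : HasCompactSupport fun v => b.normed volume (z - v) :=
      (b.hasCompactSupport_normed (μ := volume)).comp_homeomorph (Homeomorph.subLeft z)
    exact h1.comp_left (g := fun t : ℝ => (t : ℂ)) (by simp)
  have hconv : convolution (b.normed volume) h (ContinuousLinearMap.lsmul ℝ ℝ) volume z =
      ∫ v, h v * ψ v := by
    rw [convolution_eq_swap]
    congr 1 with v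
    rw [ContinuousLinearMap.lsmul_apply, Complex.real_smul, mul_comm]
  rw [hconv, hh.2.2 ψ hψ hψc, surfaceConv_eq_integral_prod h₁ h₂ hf hg hψ.continuous hψc]
  refine (enorm_integral_le_lintegral_enorm _).trans (le_of_eq (lintegral_congr fun p => ?_))
  rw [enorm_mul, enorm_mul, ← ofReal_norm (ψ _), Complex.norm_of_nonneg (b.nonneg_normed _),
    sub_sub]

/-- The `L²` estimate for convolutions of continuous densities, restricted to a third surface. -/
theorem exists_eLpNorm_conv_le (hβ : 0 < β) :
    ∃ C : ℝ≥0, ∀ S : Fin 3 → Set E3, TransversalTriple β 1 (1 / 2) S →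
      (∀ i, Metric.diam (S i) ≤ 1) → ∀ f g h : E3 → ℂ, IsCcOn (S 0) f → IsCcOn (S 1) g →
        IsContinuousConv (S 0) (S 1) f g h →
        eLpNorm h 2 (surfaceMeasure (S 2)) ≤
          C * (eLpNorm f 2 (surfaceMeasure (S 0)) * eLpNorm g 2 (surfaceMeasure (S 1))) := by
  obtain ⟨ε₀, hε₀, C₀, hC₀⟩ := exists_lintegral_kernel_le hβ
  set v₃ : ℝ := volume.real (Metric.ball (0 : E3) 1)
  have hv₃ : 0 < v₃ := ENNReal.toReal_pos (Metric.measure_ball_pos _ _ one_pos).ne'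
    measure_ball_lt_top.ne
  -- This is `C₀ * L ^ 2 * ε ^ 6` for the bump height `L = 8 / (ε ^ 3 * v₃)`; it controls squared
  -- norms, whence the square root in the final constant.
  set D : ℝ≥0 := C₀ * (64 / v₃ ^ 2).toNNReal
  refine ⟨NNReal.sqrt D, fun S hS hdiam f g h hf hg hh => ?_⟩
  have hkernel := hC₀ S hS hdiam
  obtain ⟨U, Φ, n, hpiece, -⟩ := hS
  have hfin : ∀ i, IsFiniteMeasure (surfaceMeasure (S i)) := fun i => (hpiece i).isFiniteMeasure hβ
  have hmeas : ∀ i, MeasurableSet (S i) := fun i => (hpiece i).isLocallyClosed.measurableSet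
  set e : ℕ → ℝ := fun m => ε₀ / (m + 1)
  have he : ∀ m, 0 < e m := fun m => by positivity
  have he₀ : ∀ m, e m ≤ ε₀ := fun m =>
    div_le_self hε₀.le (by linarith [(Nat.cast_nonneg m : (0 : ℝ) ≤ m)])
  choose b hbr hbL hb0 using fun m => exists_bump_kernel (he m)
  set H : ℕ → E3 → ℝ≥0∞ := fun m z => ∫⁻ p : E3 × E3, ‖f p.1‖ₑ * ‖g p.2‖ₑ *
    ENNReal.ofReal ((b m).normed volume (z - p.1 - p.2))
      ∂((surfaceMeasure (S 0)).prod (surfaceMeasure (S 1)))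
  have hk : ∀ m, Measurable fun v => ENNReal.ofReal ((b m).normed volume v) := fun m =>
    (b m).continuous_normed.measurable.ennreal_ofReal
  have hHm : ∀ m, Measurable (H m) := fun m => by
    refine Measurable.lintegral_prod_right' (f := fun q : E3 × E3 × E3 => ‖f q.2.1‖ₑ * ‖g q.2.2‖ₑ *
      ENNReal.ofReal ((b m).normed volume (q.1 - q.2.1 - q.2.2))) ?_
    refine Measurable.mul (Measurable.mul ?_ ?_) 
      ((hk m).comp (f := fun q : E3 × E3 × E3 => q.1 - q.2.1 - q.2.2) (by fun_prop))
    · exact hf.measurable.enorm.comp (measurable_fst.comp measurable_snd)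
    · exact hg.measurable.enorm.comp (measurable_snd.comp measurable_snd)
  have hbound : ∀ m, ∫⁻ z, H m z ^ 2 ∂surfaceMeasure (S 2) ≤
      D * ((∫⁻ x, ‖f x‖ₑ ^ 2 ∂surfaceMeasure (S 0)) *
        ∫⁻ y, ‖g y‖ₑ ^ 2 ∂surfaceMeasure (S 1)) := by
    intro m
    refine lintegral_conv_sq_le (hk m) (fun p q => ?_) hf.measurable.enorm hg.measurable.enorm
    refine (hkernel (e m) (he m) (he₀ m) _ _ (hbL m) (hb0 m) p q).trans (le_of_eq ?_)
    have hem := he m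
    rw [← ENNReal.ofReal_pow (by positivity), ← ENNReal.ofReal_pow hem.le,
      ← ENNReal.ofReal_mul (by positivity), ENNReal.coe_mul]
    congr 1
    change _ = ENNReal.ofReal _
    congr 1
    change (8 / (e m ^ 3 * v₃)) ^ 2 * e m ^ 6 = 64 / v₃ ^ 2
    have hem' := hem.ne'
    generalize e m = r at hem'
    field_simp
    norm_num
  -- Because `h` is continuous, its mollifications converge at every point, in particular on the
  -- null set `S 2`; Fatou then transfers `hbound`.
  have hpt : ∀ z, ‖h z‖ₑ ^ 2 ≤ liminf (fun m => H m z ^ 2) atTop := by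
    intro z
    have hlim : Tendsto (fun m => (b m).rOut) atTop (𝓝 0) := by
      simp_rw [hbr]
      exact tendsto_const_div_atTop_nhds_zero_nat ε₀ |>.comp (tendsto_add_atTop_nat 1) |>.congr
        fun m => by simp [e]
    have ht := ContDiffBump.convolution_tendsto_right_of_continuous (μ := volume) hlim hh.1 z
    have ht2 := ((ENNReal.continuous_pow 2).tendsto _).comp ht.enorm
    rw [← ht2.liminf_eq]
    refine liminf_le_liminf (Eventually.of_forall fun m => ?_)
    exact pow_le_pow_left' (hh.enorm_convolution_le (hmeas 0) (hmeas 1) hf hg (b m) z) 2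
  have hsq : eLpNorm h 2 (surfaceMeasure (S 2)) ^ 2 ≤
      (NNReal.sqrt D * (eLpNorm f 2 (surfaceMeasure (S 0)) *
        eLpNorm g 2 (surfaceMeasure (S 1)))) ^ 2 := by
    rw [mul_pow, mul_pow, eLpNorm_two_sq_eq_lintegral, eLpNorm_two_sq_eq_lintegral,
      eLpNorm_two_sq_eq_lintegral, ← ENNReal.coe_pow, NNReal.sq_sqrt]
    calc _ ≤ ∫⁻ z, liminf (fun m => H m z ^ 2) atTop ∂surfaceMeasure (S 2) := lintegral_mono hpt
      _ ≤ liminf (fun m => ∫⁻ z, H m z ^ 2 ∂surfaceMeasure (S 2)) atTop :=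
        lintegral_liminf_le fun m => (hHm m).pow_const 2
      _ ≤ liminf (fun _ : ℕ => _) atTop :=
        liminf_le_liminf (Eventually.of_forall hbound)
      _ = _ := liminf_const _
  exact (ENNReal.pow_le_pow_left_iff two_ne_zero).1 hsq

end Estimate

/-! ### Extension from `C_c` to L² -/

section Density

/-- A locally closed set is a locally compact space, where `C_c` is dense in L²; the approximants
are extended by zero. -/
theorem exists_isCcOn_eLpNorm_sub_le {S : Set E3} (hS : IsLocallyClosed S)
    [IsFiniteMeasure (surfaceMeasure S)] {f : E3 → ℂ} (hf : MemLp f 2 (surfaceMeasure S))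
    {ε : ℝ≥0∞} (hε : ε ≠ 0) :
    ∃ φ, IsCcOn S φ ∧ eLpNorm (fun x => φ x - f x) 2 (surfaceMeasure S) ≤ ε := by
  have hSm := hS.measurableSet
  have hemb : MeasurableEmbedding (Subtype.val : S → E3) := MeasurableEmbedding.subtype_coe hSm
  set μ : Measure S := (surfaceMeasure S).comap Subtype.val
  have hmap : μ.map Subtype.val = surfaceMeasure S := by
    rw [map_comap_subtype_coe hSm, surfaceMeasure, Measure.restrict_restrict hSm, Set.inter_self]
  have : LocallyCompactSpace S := hS.locallyCompactSpace
  have : IsFiniteMeasure μ := ⟨by rw [hemb.comap_apply]; exact measure_lt_top _ _⟩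
  have hfS : MemLp (f ∘ Subtype.val) 2 μ := by
    rw [← hmap] at hf
    exact (hemb.memLp_map_measure_iff).1 hf
  obtain ⟨g, hgc, hge, hg, -⟩ := hfS.exists_hasCompactSupport_eLpNorm_sub_le (by simp) hε
  have hext : ∀ x : S, Function.extend Subtype.val g 0 (x : E3) = g x := fun x =>
    Subtype.val_injective.extend_apply g 0 x
  refine ⟨Function.extend Subtype.val g 0, ⟨?_, Subtype.val '' tsupport g,
    hgc.isCompact.image continuous_subtype_val, ?_, fun x hx => ?_⟩, ?_⟩
  · rw [continuousOn_iff_continuous_domRestrict]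
    exact hg.congr fun x => (hext x).symm
  · rintro _ ⟨x, -, rfl⟩
    exact x.2
  · by_cases hxS : x ∈ S
    · rw [hext ⟨x, hxS⟩]
      exact image_eq_zero_of_notMem_tsupport fun h => hx ⟨_, h, rfl⟩
    · exact Function.extend_apply' _ _ _ fun ⟨y, hy⟩ => hxS (hy ▸ y.2)
  · rw [← hmap, hemb.eLpNorm_map_measure]
    refine le_of_eq_of_le ?_ hge
    rw [← eLpNorm_neg]
    congr 1
    ext x
    simp

variable {S₁ S₂ S₃ : Set E3} [IsFiniteMeasure (surfaceMeasure S₁)]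
  [IsFiniteMeasure (surfaceMeasure S₂)]

/-- Convolutions depend continuously on the two factors. -/
theorem tendsto_eLpNorm_conv_sub {C : ℝ≥0} (h₁ : MeasurableSet S₁) (h₂ : MeasurableSet S₂)
    (hex : ∀ f g : E3 → ℂ, IsCcOn S₁ f → IsCcOn S₂ g → ∃ h, IsContinuousConv S₁ S₂ f g h)
    (hC : ∀ f g h : E3 → ℂ, IsCcOn S₁ f → IsCcOn S₂ g → IsContinuousConv S₁ S₂ f g h →
      eLpNorm h 2 (surfaceMeasure S₃) ≤
        C * (eLpNorm f 2 (surfaceMeasure S₁) * eLpNorm g 2 (surfaceMeasure S₂)))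
    (f : Lp ℂ 2 (surfaceMeasure S₁)) (g : Lp ℂ 2 (surfaceMeasure S₂)) {ι : Type*} {l : Filter ι}
    {φ γ h φ' γ' h' : ι → E3 → ℂ} (hφ : ∀ i, IsCcOn S₁ (φ i)) (hγ : ∀ i, IsCcOn S₂ (γ i))
    (hh : ∀ i, IsContinuousConv S₁ S₂ (φ i) (γ i) (h i)) (hφ' : ∀ i, IsCcOn S₁ (φ' i))
    (hγ' : ∀ i, IsCcOn S₂ (γ' i)) (hh' : ∀ i, IsContinuousConv S₁ S₂ (φ' i) (γ' i) (h' i))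
    (tφ : Tendsto (fun i => eLpNorm (fun x => φ i x - f x) 2 (surfaceMeasure S₁)) l (𝓝 0))
    (tγ : Tendsto (fun i => eLpNorm (fun x => γ i x - g x) 2 (surfaceMeasure S₂)) l (𝓝 0))
    (tφ' : Tendsto (fun i => eLpNorm (fun x => φ' i x - f x) 2 (surfaceMeasure S₁)) l (𝓝 0))
    (tγ' : Tendsto (fun i => eLpNorm (fun x => γ' i x - g x) 2 (surfaceMeasure S₂)) l (𝓝 0)) :
    Tendsto (fun i => eLpNorm (h i - h' i) 2 (surfaceMeasure S₃)) l (𝓝 0) := by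
  have hfm := (Lp.aestronglyMeasurable f)
  have hgm := (Lp.aestronglyMeasurable g)
  have dφ : ∀ i, eLpNorm (φ i - φ' i) 2 (surfaceMeasure S₁) ≤
      eLpNorm (fun x => φ i x - f x) 2 (surfaceMeasure S₁) +
      eLpNorm (fun x => φ' i x - f x) 2 (surfaceMeasure S₁) := fun i => by
    have : φ i - φ' i = (fun x => φ i x - f x) - fun x => φ' i x - f x := by
      ext x; simp
    rw [this]
    exact eLpNorm_sub_le (((hφ i).aestronglyMeasurable h₁).sub hfm)
      (((hφ' i).aestronglyMeasurable h₁).sub hfm) one_le_two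
  have dγ : ∀ i, eLpNorm (γ i - γ' i) 2 (surfaceMeasure S₂) ≤
      eLpNorm (fun x => γ i x - g x) 2 (surfaceMeasure S₂) +
      eLpNorm (fun x => γ' i x - g x) 2 (surfaceMeasure S₂) := fun i => by
    have : γ i - γ' i = (fun x => γ i x - g x) - fun x => γ' i x - g x := by
      ext x; simp
    rw [this]
    exact eLpNorm_sub_le (((hγ i).aestronglyMeasurable h₂).sub hgm)
      (((hγ' i).aestronglyMeasurable h₂).sub hgm) one_le_two
  have bγ : ∀ i, eLpNorm (γ i) 2 (surfaceMeasure S₂) ≤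
      eLpNorm (fun x => γ i x - g x) 2 (surfaceMeasure S₂) +
      eLpNorm g 2 (surfaceMeasure S₂) := fun i => by
    have : γ i = (fun x => γ i x - g x) + g := by
      ext x; simp
    conv_lhs => rw [this]
    exact eLpNorm_add_le (((hγ i).aestronglyMeasurable h₂).sub hgm) hgm one_le_two
  have bφ' : ∀ i, eLpNorm (φ' i) 2 (surfaceMeasure S₁) ≤
      eLpNorm (fun x => φ' i x - f x) 2 (surfaceMeasure S₁) +
      eLpNorm f 2 (surfaceMeasure S₁) := fun i => by
    have : φ' i = (fun x => φ' i x - f x) + f := by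
      ext x; simp
    conv_lhs => rw [this]
    exact eLpNorm_add_le (((hφ' i).aestronglyMeasurable h₁).sub hfm) hfm one_le_two
  have hle : ∀ i, eLpNorm (h i - h' i) 2 (surfaceMeasure S₃) ≤
      C * ((eLpNorm (fun x => φ i x - f x) 2 (surfaceMeasure S₁) +
        eLpNorm (fun x => φ' i x - f x) 2 (surfaceMeasure S₁)) *
        (eLpNorm (fun x => γ i x - g x) 2 (surfaceMeasure S₂) +
          eLpNorm g 2 (surfaceMeasure S₂))) +
      C * ((eLpNorm (fun x => φ' i x - f x) 2 (surfaceMeasure S₁) +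
          eLpNorm f 2 (surfaceMeasure S₁)) *
        (eLpNorm (fun x => γ i x - g x) 2 (surfaceMeasure S₂) +
          eLpNorm (fun x => γ' i x - g x) 2 (surfaceMeasure S₂))) := fun i => by
    -- The mixed convolution splits `h - h'` into convolutions of `φ - φ'` with `γ` and of `φ'` with
    -- `γ - γ'`, each controlled by `hC`.
    obtain ⟨k, hk⟩ := hex (φ' i) (γ i) (hφ' i) (hγ i)
    have c1 : IsContinuousConv S₁ S₂ (φ i - φ' i) (γ i) (h i - k) := by
      rw [sub_eq_add_neg, sub_eq_add_neg]
      exact (hh i).add_left h₁ h₂ (hφ i) (hφ' i).neg (hγ i) hk.neg_left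
    have c2 : IsContinuousConv S₁ S₂ (φ' i) (γ i - γ' i) (k - h' i) := by
      rw [sub_eq_add_neg, sub_eq_add_neg]
      exact hk.add_right h₁ h₂ (hφ' i) (hγ i) (hγ' i).neg (hh' i).neg_right
    have e1 := hC _ _ _ ((hφ i).sub (hφ' i)) (hγ i) c1
    have e2 := hC _ _ _ (hφ' i) ((hγ i).sub (hγ' i)) c2
    have : h i - h' i = (h i - k) + (k - h' i) := by abel
    rw [this]
    refine (eLpNorm_add_le c1.1.aestronglyMeasurable c2.1.aestronglyMeasurable one_le_two).trans ?_
    refine add_le_add (e1.trans ?_) (e2.trans ?_)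
    · gcongr
      exacts [dφ i, bγ i]
    · gcongr
      exacts [bφ' i, dγ i]
  have hfT : eLpNorm f 2 (surfaceMeasure S₁) ≠ ⊤ := (Lp.eLpNorm_lt_top f).ne
  have hgT : eLpNorm g 2 (surfaceMeasure S₂) ≠ ⊤ := (Lp.eLpNorm_lt_top g).ne
  refine tendsto_of_tendsto_of_tendsto_of_le_of_le tendsto_const_nhds ?_
    (fun i => zero_le) hle
  have t1 := ENNReal.Tendsto.const_mul (a := (C : ℝ≥0∞)) (ENNReal.Tendsto.mul (tφ.add tφ')
    (Or.inr (by simpa using hgT)) (tγ.add_const (eLpNorm g 2 (surfaceMeasure S₂)))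
    (Or.inr (by simp))) (Or.inr ENNReal.coe_ne_top)
  have t2 := ENNReal.Tendsto.const_mul (a := (C : ℝ≥0∞)) (ENNReal.Tendsto.mul
    (tφ'.add_const (eLpNorm f 2 (surfaceMeasure S₁)))
    (Or.inr (by simp)) (tγ.add tγ') (Or.inr (by simpa using hfT))) (Or.inr ENNReal.coe_ne_top)
  simpa using t1.add t2

/-- Extension of the restricted convolution by density. -/
theorem exists_isConvRestriction {C : ℝ≥0} (h₁ : IsLocallyClosed S₁) (h₂ : IsLocallyClosed S₂)
    (hex : ∀ f g : E3 → ℂ, IsCcOn S₁ f → IsCcOn S₂ g → ∃ h, IsContinuousConv S₁ S₂ f g h)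
    (hC : ∀ f g h : E3 → ℂ, IsCcOn S₁ f → IsCcOn S₂ g → IsContinuousConv S₁ S₂ f g h →
      eLpNorm h 2 (surfaceMeasure S₃) ≤
        C * (eLpNorm f 2 (surfaceMeasure S₁) * eLpNorm g 2 (surfaceMeasure S₂)))
    (f : Lp ℂ 2 (surfaceMeasure S₁)) (g : Lp ℂ 2 (surfaceMeasure S₂)) :
    ∃ F : Lp ℂ 2 (surfaceMeasure S₃), IsConvRestriction S₁ S₂ S₃ f g F ∧
      (∀ F', IsConvRestriction S₁ S₂ S₃ f g F' → F' = F) ∧ ‖F‖ ≤ C * ‖f‖ * ‖g‖ := by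
  have hm₁ := h₁.measurableSet
  have hm₂ := h₂.measurableSet
  have hpos : ∀ k : ℕ, ((k : ℝ≥0∞) + 1)⁻¹ ≠ 0 := fun k =>
    ENNReal.inv_ne_zero.2 (by simp)
  choose φ hφ hφf using fun k : ℕ => exists_isCcOn_eLpNorm_sub_le h₁ (Lp.memLp f) (hpos k)
  choose γ hγ hγg using fun k : ℕ => exists_isCcOn_eLpNorm_sub_le h₂ (Lp.memLp g) (hpos k)
  choose h hh using fun k => hex (φ k) (γ k) (hφ k) (hγ k)
  have hinv : Tendsto (fun k : ℕ => ((k : ℝ≥0∞) + 1)⁻¹) atTop (𝓝 0) := by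
    have := ENNReal.tendsto_inv_nat_nhds_zero.comp (tendsto_add_atTop_nat 1)
    simpa [Function.comp_def] using this
  have tφ : Tendsto (fun k => eLpNorm (fun x => φ k x - f x) 2 (surfaceMeasure S₁)) atTop (𝓝 0) :=
    tendsto_of_tendsto_of_tendsto_of_le_of_le tendsto_const_nhds hinv (fun _ => zero_le) hφf
  have tγ : Tendsto (fun k => eLpNorm (fun x => γ k x - g x) 2 (surfaceMeasure S₂)) atTop (𝓝 0) :=
    tendsto_of_tendsto_of_tendsto_of_le_of_le tendsto_const_nhds hinv (fun _ => zero_le) hγg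
  have hmem : ∀ k, MemLp (h k) 2 (surfaceMeasure S₃) := fun k =>
    ⟨(hh k).1.aestronglyMeasurable, (hC _ _ _ (hφ k) (hγ k) (hh k)).trans_lt
      (ENNReal.mul_lt_top ENNReal.coe_lt_top (ENNReal.mul_lt_top
        ((hφ k).memLp hm₁).eLpNorm_lt_top ((hγ k).memLp hm₂).eLpNorm_lt_top))⟩
  have hcauchy : CauchySeq fun k => (hmem k).toLp (h k) := by
    rw [cauchySeq_iff_tendsto_dist_atTop_0]
    -- Indexing by pairs in `ℕ × ℕ` turns continuity of the convolution into the Cauchy property.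
    have t := tendsto_eLpNorm_conv_sub (S₃ := S₃) hm₁ hm₂ hex hC f g (l := atTop)
      (fun i : ℕ × ℕ => hφ i.1) (fun i => hγ i.1) (fun i => hh i.1) (fun i => hφ i.2)
      (fun i => hγ i.2) (fun i => hh i.2)
      (by rw [← prod_atTop_atTop_eq]; exact tφ.comp tendsto_fst)
      (by rw [← prod_atTop_atTop_eq]; exact tγ.comp tendsto_fst)
      (by rw [← prod_atTop_atTop_eq]; exact tφ.comp tendsto_snd)
      (by rw [← prod_atTop_atTop_eq]; exact tγ.comp tendsto_snd)
    have t' := (ENNReal.tendsto_toReal ENNReal.zero_ne_top).comp t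
    refine t'.congr fun i => ?_
    rw [dist_edist, Lp.edist_toLp_toLp]
    rfl
  obtain ⟨F, hF⟩ := cauchySeq_tendsto_of_complete hcauchy
  have tF : Tendsto (fun k => eLpNorm (h k - (F : E3 → ℂ)) 2 (surfaceMeasure S₃)) atTop (𝓝 0) := by
    have := tendsto_iff_edist_tendsto_0.1 hF
    refine this.congr fun k => ?_
    rw [Lp.edist_def]
    exact eLpNorm_congr_ae ((hmem k).coeFn_toLp.sub (ae_eq_refl _))
  have hFm := Lp.aestronglyMeasurable F
  refine ⟨F, ?_, fun F' hF' => ?_, ?_⟩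
  · intro φ' γ' h' hφ' hγ' hh' tφ' tγ'
    have t := tendsto_eLpNorm_conv_sub (S₃ := S₃) hm₁ hm₂ hex hC f g hφ' hγ' hh' hφ hγ hh
      tφ' tγ' tφ tγ
    have ts := t.add tF
    rw [add_zero] at ts
    refine tendsto_of_tendsto_of_tendsto_of_le_of_le tendsto_const_nhds ts
      (fun _ => zero_le) fun k => ?_
    have : (fun x => h' k x - F x) = (h' k - h k) + (h k - (F : E3 → ℂ)) := by
      ext x; simp
    change eLpNorm (fun x => h' k x - F x) 2 (surfaceMeasure S₃) ≤ _
    rw [this]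
    exact eLpNorm_add_le ((hh' k).1.aestronglyMeasurable.sub (hh k).1.aestronglyMeasurable)
      ((hh k).1.aestronglyMeasurable.sub hFm) one_le_two
  · have t' := hF' φ γ h hφ hγ hh tφ tγ
    have ts := tF.add t'
    rw [add_zero] at ts
    have hF'm := Lp.aestronglyMeasurable F'
    have hle : edist F' F ≤ 0 := by
      refine ge_of_tendsto' ts fun k => ?_
      rw [Lp.edist_def]
      have : (F' : E3 → ℂ) - F = (h k - (F : E3 → ℂ)) - fun x => h k x - F' x := by
        ext x; simp
      rw [this]
      exact eLpNorm_sub_le ((hh k).1.aestronglyMeasurable.sub hFm)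
        ((hh k).1.aestronglyMeasurable.sub hF'm) one_le_two
    exact edist_le_zero.1 hle
  · have hfin : ∀ (S : Set E3) (u : Lp ℂ 2 (surfaceMeasure S)), eLpNorm u 2 (surfaceMeasure S) ≠ ⊤ :=
      fun S u => (Lp.eLpNorm_lt_top u).ne
    have hle : eLpNorm F 2 (surfaceMeasure S₃) ≤
        C * (eLpNorm f 2 (surfaceMeasure S₁) * eLpNorm g 2 (surfaceMeasure S₂)) := by
      have t1 := tF.add (ENNReal.Tendsto.const_mul (a := (C : ℝ≥0∞)) (ENNReal.Tendsto.mul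
        (tφ.add_const (eLpNorm f 2 (surfaceMeasure S₁))) (Or.inr (by simpa using hfin _ g))
        (tγ.add_const (eLpNorm g 2 (surfaceMeasure S₂))) (Or.inr (by simpa using hfin _ f)))
        (Or.inr ENNReal.coe_ne_top))
      simp only [zero_add] at t1
      refine ge_of_tendsto' t1 fun k => ?_
      have e0 : (F : E3 → ℂ) = h k - (h k - (F : E3 → ℂ)) := by
        ext x; simp
      have e1 : φ k = (fun x => φ k x - f x) + f := by
        ext x; simp
      have e2 : γ k = (fun x => γ k x - g x) + g := by
        ext x; simp
      have b1 : eLpNorm (φ k) 2 (surfaceMeasure S₁) ≤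
          eLpNorm (fun x => φ k x - f x) 2 (surfaceMeasure S₁) +
          eLpNorm f 2 (surfaceMeasure S₁) := by
        conv_lhs => rw [e1]
        exact eLpNorm_add_le (((hφ k).aestronglyMeasurable hm₁).sub (Lp.aestronglyMeasurable f))
          (Lp.aestronglyMeasurable f) one_le_two
      have b2 : eLpNorm (γ k) 2 (surfaceMeasure S₂) ≤
          eLpNorm (fun x => γ k x - g x) 2 (surfaceMeasure S₂) +
          eLpNorm g 2 (surfaceMeasure S₂) := by
        conv_lhs => rw [e2]
        exact eLpNorm_add_le (((hγ k).aestronglyMeasurable hm₂).sub (Lp.aestronglyMeasurable g))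
          (Lp.aestronglyMeasurable g) one_le_two
      conv_lhs => rw [e0]
      refine (eLpNorm_sub_le (hh k).1.aestronglyMeasurable
        ((hh k).1.aestronglyMeasurable.sub hFm) one_le_two).trans ?_
      rw [add_comm]
      gcongr
      exact (hC _ _ _ (hφ k) (hγ k) (hh k)).trans (by gcongr)
    rw [Lp.norm_def, Lp.norm_def, Lp.norm_def]
    have := ENNReal.toReal_mono (ENNReal.mul_ne_top ENNReal.coe_ne_top
      (ENNReal.mul_ne_top (hfin _ f) (hfin _ g))) hle
    rwa [ENNReal.toReal_mul, ENNReal.toReal_mul, ENNReal.coe_toReal, ← mul_assoc] at this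

end Density

/-! ### Independence of the first two normals, and the conclusion -/

theorem TransversalTriple.smul_gradient_eq_zero {β : ℝ≥0} {S U : Fin 3 → Set E3}
    {Φ : Fin 3 → E3 → ℝ} {n : Fin 3 → E3 → E3}
    (hS : ∀ i, IsSurfacePiece β 1 (S i) (U i) (Φ i) (n i))
    (hdet : ∀ σ : Fin 3 → E3, (∀ i, σ i ∈ levelSurface (U i) (Φ i)) →
      1 / 2 ≤ (Matrix.of fun k i => n i (σ i) k).det) {x y : E3}
    (hx : x ∈ levelSurface (U 0) (Φ 0)) (hy : y ∈ levelSurface (U 1) (Φ 1)) {c d : ℝ}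
    (h : c • gradient (Φ 0) x = d • gradient (Φ 1) y) : c • gradient (Φ 0) x = 0 := by
  by_contra hne
  set w := c • gradient (Φ 0) x with hw
  have hc : c ≠ 0 := by rintro rfl; simp [hw] at hne
  have hd : d ≠ 0 := by rintro rfl; rw [h] at hne; simp at hne
  obtain ⟨a, ha⟩ := (hS 0).normal_dir x hx
  obtain ⟨b, hb⟩ := (hS 1).normal_dir y hy
  -- Any point of the third surface makes the determinant bound available; proportional first and
  -- second columns would make that determinant zero.
  obtain ⟨z, hz⟩ := (hS 2).nonempty
  have hnx : n 0 x = (a / c) • w := by rw [ha, hw, smul_smul, div_mul_cancel₀ _ hc]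
  have hny : n 1 y = (b / d) • w := by rw [hb, h, smul_smul, div_mul_cancel₀ _ hd]
  have hdet' := hdet ![x, y, z] (by
    intro i
    fin_cases i
    exacts [hx, hy, (hS 2).subset_levelSurface hz])
  have hzero : (Matrix.of fun k i => n i ((![x, y, z] : Fin 3 → E3) i) k).det = 0 := by
    rw [Matrix.det_fin_three]
    simp only [Matrix.of_apply, Matrix.cons_val_zero, Matrix.cons_val_one, Matrix.cons_val, hnx,
      hny, PiLp.smul_apply, smul_eq_mul]
    ring
  rw [hzero] at hdet'
  norm_num at hdet'

theorem theorem1 (β : ℝ≥0) (hβ0 : 0 < β) (hβ1 : β ≤ 1) :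
    ∃ C : ℝ, ∀ S : Fin 3 → Set E3,
      TransversalTriple β 1 (1 / 2) S → (∀ i, Metric.diam (S i) ≤ 1) →
      (∀ f g : E3 → ℂ, IsCcOn (S 0) f → IsCcOn (S 1) g →
        ∃ h : E3 → ℂ, IsContinuousConv (S 0) (S 1) f g h) ∧
      ∀ (f : Lp ℂ 2 (surfaceMeasure (S 0))) (g : Lp ℂ 2 (surfaceMeasure (S 1))),
        ∃ F : Lp ℂ 2 (surfaceMeasure (S 2)),
          IsConvRestriction (S 0) (S 1) (S 2) f g F ∧
          (∀ F', IsConvRestriction (S 0) (S 1) (S 2) f g F' → F' = F) ∧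
          ‖F‖ ≤ C * ‖f‖ * ‖g‖ := by
  obtain ⟨C, hC⟩ := exists_eLpNorm_conv_le hβ0
  refine ⟨C, fun S hS hdiam => ?_⟩
  have hbound := hC S hS hdiam
  obtain ⟨U, Φ, n, hpiece, hdet⟩ := hS
  have hfin : ∀ i, IsFiniteMeasure (surfaceMeasure (S i)) := fun i =>
    (hpiece i).isFiniteMeasure hβ0
  obtain ⟨V₀, hV₀, hSV₀⟩ := (hpiece 0).relOpen
  obtain ⟨V₁, hV₁, hSV₁⟩ := (hpiece 1).relOpen
  have hex : ∀ f g : E3 → ℂ, IsCcOn (S 0) f → IsCcOn (S 1) g →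
      ∃ h : E3 → ℂ, IsContinuousConv (S 0) (S 1) f g h := fun f g hf hg =>
    exists_isContinuousConv (hpiece 0).isOpen_U (hpiece 1).isOpen_U (hpiece 0).regular.1
      (hpiece 1).regular.1 hV₀ hV₁ hSV₀ hSV₁ (fun x hx y hy c d h =>
        TransversalTriple.smul_gradient_eq_zero hpiece (fun σ hσ => (hdet σ hσ).1) hx hy h) hf hg
  exact ⟨hex, exists_isConvRestriction (hpiece 0).isLocallyClosed (hpiece 1).isLocallyClosed hex
    hbound⟩
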